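/- Fix $d\ge 2$ and $k\ge 1$, and give $\mathbb R^d$ its Euclidean norm. For $E\subset\mathbb R^d$ and $\vec t=(t_1,\dots,t_k)\in(0,\infty)^k$ let $$VS^k_{\vec t}(E)=\{(x_1,\dots,x_{k+1})\in E^{k+1} : |x_i-x_{i+1}|=t_i \text{ for } 1\le i\le k,\ x_1,\dots,x_{k+1}\text{ pairwise distinct}\}\subset(\mathbb R^d)^{k+1}.$$ Let $\alpha>0$. For $\delta>0$ write $E_\delta=E+B(0,\delta)$, and write $|\cdot|$ also for Lebesgue measure on $\mathbb R^d$. A compact set $E\subset\mathbb R^d$ is called $\{\delta_i\}$-discrete $\alpha$-regular if there is a sequence $\delta_i>0$ with $\delta_i\to0$ such that for all sufficiently small $\epsilon>0$ there is a constant $C_\epsilon$ with $$|E_{\delta_i}\cap B(x,r)|\le C_\epsilon\left(\frac r{\delta_i}\right)^{\alpha+\epsilon}\delta_i^{\,d-\epsilon}\qquad\text{for all } i,\ \text{all } x\in\mathbb R^d \text{ and all } r\ge\delta_i .$$ Define $$g_d(VS^k_{\vec t},\alpha)=\sup\{\dim_{\mathcal H}VS^k_{\vec t}(E) : E\subset\mathbb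 R^d \text{ compact},\ E\text{ is }\{\delta_i\}\text{-discrete }\alpha\text{-regular},\ \dim_{\mathcal H}E=\alpha\}.$$ **Theorem.** (1) Let $k\ge1$, $d\ge4$ and $0<\alpha\le\lfloor d/2\rfloor-1$. Then $g_d(VS^k_{\vec t},\alpha)=(k+1)\alpha$ for every $\vec t\in(0,\infty)^k$ with $t_1\le\cdots\le t_k$. (2) Let $0<\alpha\le1$. Then $g_2(VS^2_{\vec t},\alpha)=2\alpha$ for every $\vec t=(t_1,t_2)\in(0,\infty)^2$. -/

import Mathlib

open Filter Topology MeasureTheory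

/-- `VS^k_t(E)`: the set of `k`-chains `(x_1, …, x_{k+1})` of pairwise distinct points of
`E ⊆ ℝ^d` whose consecutive distances are the prescribed gaps `t_1, …, t_k`. It is a subset of
`(ℝ^d)^{k+1}`, which carries the product (maximum) metric; this metric is bi-Lipschitz equivalent
to the Euclidean one, so the Hausdorff dimension is the usual one. -/
def chainSet {d k : ℕ} (t : Fin k → ℝ) (E : Set (EuclideanSpace ℝ (Fin d))) :
    Set (Fin (k + 1) → EuclideanSpace ℝ (Fin d)) :=
  {x | (∀ j, x j ∈ E) ∧ (∀ i : Fin k, dist (x i.castSucc) (x i.succ) = t i) ∧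
    Function.Injective x}

/-- `E ⊆ ℝ^d` is `{δ_i}`-discrete `α`-regular: there are scales `δ_i > 0` tending to `0` such that,
for every sufficiently small `ε > 0`, there is a constant `C = C_ε` with
`|E_{δ_i} ∩ B(x, r)| ≤ C (r / δ_i)^(α + ε) δ_i^(d - ε)` for all `i`, all `x` and all `r ≥ δ_i`.
Here `E_δ` is the open `δ`-neighbourhood of `E` and `|·|` is Lebesgue measure. -/
def IsDiscreteRegular {d : ℕ} (α : ℝ) (E : Set (EuclideanSpace ℝ (Fin d))) : Prop :=
  ∃ δ : ℕ → ℝ, (∀ i, 0 < δ i) ∧ Tendsto δ atTop (𝓝 0) ∧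
    ∃ ε₀ : ℝ, 0 < ε₀ ∧ ∀ ε : ℝ, 0 < ε → ε < ε₀ →
      ∃ C : ℝ, 0 < C ∧ ∀ (i : ℕ) (x : EuclideanSpace ℝ (Fin d)) (r : ℝ), δ i ≤ r →
        volume (Metric.thickening (δ i) E ∩ Metric.ball x r) ≤
          ENNReal.ofReal (C * ((r / δ i) ^ (α + ε) * (δ i) ^ ((d : ℝ) - ε)))

/-- `g_d(VS^k_t, α)`: the supremum (in `[0, ∞]`) of the Hausdorff dimension of `VS^k_t(E)` over all
compact `{δ_i}`-discrete `α`-regular sets `E ⊆ ℝ^d` of Hausdorff dimension `α`. -/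
noncomputable def chainDim (d : ℕ) {k : ℕ} (t : Fin k → ℝ) (α : ℝ) : ENNReal :=
  ⨆ E ∈ {E : Set (EuclideanSpace ℝ (Fin d)) |
      IsCompact E ∧ IsDiscreteRegular α E ∧ dimH E = ENNReal.ofReal α},
    dimH (chainSet t E)

/-! Upper bounds. Regularity at the scales `δ i` bounds the number of `δ i`-balls needed to cover
`E` by about `δ i ^ (-α - 2ε)`. Covering powers of `E` by products of these balls gives dimension at
most `n * α` for the `n`-fold power (`IsDiscreteRegular.dimH_pow_le`), which is already the bound in
(1). In (2) a planar 2-chain depends on only two of its points: a collinear chain is a linear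
function of its first two points, and near a non-collinear chain the middle point is a Lipschitz
function of the end points (`abs_planeDet_mul_dist_le`). So the dimension is at most that of the
square of `E`.

Lower bounds. If `u`, `v` are orthogonal of norms `ρ`, `ρ'`, then `dist u v ^ 2 = ρ ^ 2 + ρ' ^ 2`,
whatever their directions. For (1), split off two orthogonal subspaces of dimension `⌊d/2⌋` and
place `α`-dimensional Cantor patches on spheres alternately in the two, with radii adapted to the
gaps (`exists_radii`). Any choice of one point per patch is a chain, so the chain set contains a
full product of `k + 1` patches. For (2), take the origin as middle point and patches on the circles
of radii `t 0` and `t 1`.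

The patches are bi-Lipschitz copies of powers of a Cantor set (`exists_cantor_sphere_patches`).
Their products are bounded below in dimension by the Hölder digit map onto a cube
(`le_dimH_range_of_cantorPoint`), and their regularity follows by counting truncated digit strings
(`volumeRegular_range_of_cantorPoint`). -/

/-! ### Upper bound for powers of a regular set -/

/-- A compact set is covered by finitely many closed balls of radius `δ`, centred in it, whose
halves are disjoint balls inside the open `δ`-neighbourhood. -/
theorem exists_finset_cover_mul_volume_le {d : ℕ} {E : Set (EuclideanSpace ℝ (Fin d))}
    (hE : IsCompact E) {δ : ℝ} (hδ : 0 < δ) :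
    ∃ N : Finset (EuclideanSpace ℝ (Fin d)), (∀ x ∈ E, ∃ y ∈ N, dist x y ≤ δ) ∧
      (N.card : ENNReal) * volume (Metric.ball (0 : EuclideanSpace ℝ (Fin d)) (δ / 2)) ≤
        volume (Metric.thickening δ E) := by
  lift δ to NNReal using hδ.le
  have hδ' : δ ≠ 0 := by rintro rfl; simp at hδ
  have hfin : Metric.packingNumber δ E ≠ ⊤ := by
    obtain ⟨N, -, hNf, hN⟩ := Metric.exists_finite_isCover_of_isCompact
      (ε := δ / 2) (by positivity) hE
    have h1 := Metric.packingNumber_two_mul_le_externalCoveringNumber (δ / 2) E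
    rw [mul_div_cancel₀ _ (two_ne_zero)] at h1
    exact ne_top_of_le_ne_top (Set.encard_ne_top_iff.2 hNf)
      (h1.trans hN.externalCoveringNumber_le_encard)
  have hSf : (Metric.maximalSeparatedSet δ E).Finite := by
    rw [← Set.encard_ne_top_iff, Metric.encard_maximalSeparatedSet hfin]
    exact hfin
  refine ⟨hSf.toFinset, fun x hx => ?_, ?_⟩
  · obtain ⟨y, hy, hxy⟩ := Metric.isCover_maximalSeparatedSet hfin hx
    refine ⟨y, by simpa using hy, ?_⟩
    rw [dist_le_coe, ← edist_le_coe]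
    exact hxy
  · have hdisj : (hSf.toFinset : Set (EuclideanSpace ℝ (Fin d))).PairwiseDisjoint
        (fun y => Metric.ball y ((δ : ℝ) / 2)) := by
      intro x hx y hy hxy
      have h := Metric.isSeparated_maximalSeparatedSet (by simpa using hx) (by simpa using hy) hxy
      apply Metric.ball_disjoint_ball
      rw [add_halves]
      have : (δ : ENNReal) < edist x y := h
      rw [edist_nndist] at this
      have : δ < nndist x y := by exact_mod_cast this
      exact le_of_lt (by exact_mod_cast this)
    calc _ = ∑ y ∈ hSf.toFinset, volume (Metric.ball y ((δ : ℝ) / 2)) := by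
          simp [Measure.addHaar_ball_center]
      _ = volume (⋃ y ∈ hSf.toFinset, Metric.ball y ((δ : ℝ) / 2)) :=
          (measure_biUnion_finset hdisj fun _ _ => measurableSet_ball).symm
      _ ≤ _ := by
          apply measure_mono
          simp only [Set.iUnion_subset_iff]
          intro y hy
          refine (Metric.ball_subset_ball (half_le_self hδ.le)).trans ?_
          exact Metric.ball_subset_thickening
            (Metric.maximalSeparatedSet_subset (by simpa using hy)) _

/-- The `n`-fold power of a compact discrete `α`-regular set has Hausdorff dimension at most
`n * α`. -/
theorem IsDiscreteRegular.dimH_pow_le {d : ℕ} {α : ℝ} {E : Set (EuclideanSpace ℝ (Fin d))}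
    (hα : 0 < α) (hE : IsCompact E) (hr : IsDiscreteRegular α E) (n : ℕ) :
    dimH {x : Fin n → EuclideanSpace ℝ (Fin d) | ∀ j, x j ∈ E} ≤ ENNReal.ofReal (n * α) := by
  obtain ⟨δ, hδ, hδ0, ε₀, hε₀, H⟩ := hr
  have key : ∀ ε : ℝ, 0 < ε → ε < ε₀ →
      dimH {x : Fin n → EuclideanSpace ℝ (Fin d) | ∀ j, x j ∈ E} ≤
        ENNReal.ofReal (n * (α + 2 * ε)) := by
    intro ε hε hε'
    obtain ⟨C, hC, hvol⟩ := H ε hε hε'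
    obtain ⟨R, hR⟩ := hE.isBounded.subset_ball (0 : EuclideanSpace ℝ (Fin d))
    set ρ : ℝ := max R 0 + 1 with hρ
    have hρ1 : 1 ≤ ρ := by simp [hρ]
    set V : ℝ := volume.real (Metric.ball (0 : EuclideanSpace ℝ (Fin d)) 1) with hV
    have hVpos : 0 < V :=
      ENNReal.toReal_pos (Metric.measure_ball_pos volume _ one_pos).ne' measure_ball_lt_top.ne
    have hVof : volume (Metric.ball (0 : EuclideanSpace ℝ (Fin d)) 1) = ENNReal.ofReal V :=
      (ENNReal.ofReal_toReal measure_ball_lt_top.ne).symm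
    choose N hN hNv using fun i => exists_finset_cover_mul_volume_le hE (hδ i)
    -- The factor `2 ^ d / V` comes from the volume of the balls of radius `δ i / 2`. The regularity
    -- hypothesis loses `ε` twice, in the power of `r / δ i` and in that of `δ i`, hence the
    -- exponent `α + 2 * ε` below.
    set M : ℝ := C * 2 ^ d * ρ ^ (α + ε) / V with hM
    have hM0 : 0 ≤ M := by positivity
    have hcount : ∀ᶠ i in atTop, ((N i).card : ℝ) * δ i ^ (α + 2 * ε) ≤ M := by
      filter_upwards [hδ0.eventually (gt_mem_nhds one_pos)] with i hi
      have hsub : Metric.thickening (δ i) E ⊆ Metric.ball 0 ρ := by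
        intro x hx
        obtain ⟨z, hz, hxz⟩ := Metric.mem_thickening_iff.1 hx
        have := hR hz
        rw [Metric.mem_ball] at this ⊢
        calc dist x 0 ≤ dist x z + dist z 0 := dist_triangle _ _ _
          _ < 1 + R := add_lt_add (hxz.trans hi) this
          _ ≤ ρ := by rw [hρ]; linarith [le_max_left R 0]
      have h0 := hvol i 0 ρ (hi.le.trans hρ1)
      rw [Set.inter_eq_left.2 hsub] at h0
      have h1 := (hNv i).trans h0
      have hpos := hδ i
      rw [Measure.addHaar_ball_of_pos _ _ (half_pos hpos), finrank_euclideanSpace_fin, hVof,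
        ← ENNReal.ofReal_mul (by positivity), ← ENNReal.ofReal_natCast,
        ← ENNReal.ofReal_mul (by positivity), ENNReal.ofReal_le_ofReal_iff (by positivity)] at h1
      rw [hM, le_div_iff₀ hVpos]
      have e1 : (ρ / δ i) ^ (α + ε) * δ i ^ ((d : ℝ) - ε) * δ i ^ (α + 2 * ε)
          = ρ ^ (α + ε) * δ i ^ d := by
        rw [Real.div_rpow (by positivity) hpos.le, div_mul_eq_mul_div, div_mul_eq_mul_div,
          div_eq_iff (by positivity), ← Real.rpow_natCast, mul_assoc, mul_assoc,
          ← Real.rpow_add hpos, ← Real.rpow_add hpos]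
        ring_nf
      have h2 := mul_le_mul_of_nonneg_right h1 (Real.rpow_nonneg hpos.le (α + 2 * ε))
      rw [mul_assoc C, e1, div_pow] at h2
      have h3 : 0 < δ i ^ d := by positivity
      refine le_of_mul_le_mul_right ?_ h3
      have h4 : (0 : ℝ) < 2 ^ d := by positivity
      calc (N i).card * δ i ^ (α + 2 * ε) * V * δ i ^ d
          = 2 ^ d * ((N i).card * (δ i ^ d / 2 ^ d * V) * δ i ^ (α + 2 * ε)) := by
            field_simp
        _ ≤ 2 ^ d * (C * (ρ ^ (α + ε) * δ i ^ d)) := by gcongr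
        _ = _ := by ring
    have hs : (0 : ℝ) ≤ n * (α + 2 * ε) := by positivity
    rw [← Real.coe_toNNReal _ hs]
    rw [ENNReal.ofReal_coe_nnreal]
    apply dimH_le_of_hausdorffMeasure_ne_top
    rw [Real.coe_toNNReal _ hs]
    refine ne_top_of_le_ne_top (b := ENNReal.ofReal (M ^ n * 2 ^ (n * (α + 2 * ε))))
      ENNReal.ofReal_ne_top ?_
    have hr0 : Tendsto (fun i => ENNReal.ofReal (2 * δ i)) atTop (𝓝 0) := by
      have : Tendsto (fun i => 2 * δ i) atTop (𝓝 (2 * 0)) := hδ0.const_mul 2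
      simpa using ENNReal.tendsto_ofReal this
    have hdiam : ∀ i, ∀ y : Fin n → N i, Metric.ediam
        (Metric.closedBall (fun j => (y j : EuclideanSpace ℝ (Fin d))) (δ i)) ≤
          ENNReal.ofReal (2 * δ i) := by
      intro i y
      refine Metric.ediam_le_of_forall_dist_le fun a ha b hb => ?_
      rw [Metric.mem_closedBall] at ha hb
      linarith [dist_triangle_right a b (fun j => (y j : EuclideanSpace ℝ (Fin d)))]
    -- In the maximum metric a product of `δ i`-balls is again a `δ i`-ball. Covers along one
    -- sequence of scales tending to zero suffice to bound the Hausdorff measure.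
    refine (Measure.hausdorffMeasure_le_liminf_sum (ι := fun i => (Fin n → N i)) _ _ _ hr0
      (fun i y => Metric.closedBall (fun j => (y j : EuclideanSpace ℝ (Fin d))) (δ i))
      (.of_forall hdiam) (.of_forall ?_)).trans ?_
    · intro i x hx
      choose y hy hxy using fun j => hN i (x j) (hx j)
      refine Set.mem_iUnion.2 ⟨fun j => ⟨y j, hy j⟩, ?_⟩
      rw [Metric.mem_closedBall, dist_pi_le_iff (hδ i).le]
      exact hxy
    · refine Filter.liminf_le_of_frequently_le' (Eventually.frequently ?_)
      filter_upwards [hcount] with i hi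
      have hpos := hδ i
      calc _ ≤ ∑ _y : Fin n → N i, ENNReal.ofReal (2 * δ i) ^ ((n : ℝ) * (α + 2 * ε)) :=
            Finset.sum_le_sum fun y _ => ENNReal.rpow_le_rpow (hdiam i y) hs
        _ = ENNReal.ofReal (((N i).card : ℝ) ^ n * (2 * δ i) ^ ((n : ℝ) * (α + 2 * ε))) := by
            rw [ENNReal.ofReal_rpow_of_pos (by positivity)]
            simp [ENNReal.ofReal_mul, ENNReal.ofReal_pow]
        _ ≤ _ := by
            apply ENNReal.ofReal_le_ofReal
            rw [Real.mul_rpow (by norm_num) hpos.le, mul_comm (n : ℝ), Real.rpow_mul hpos.le,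
              Real.rpow_natCast, mul_left_comm, ← mul_pow, mul_comm]
            gcongr
  have hlim : Tendsto (fun ε : ℝ => ENNReal.ofReal (n * (α + 2 * ε))) (𝓝[>] 0)
      (𝓝 (ENNReal.ofReal (n * α))) := by
    have : Tendsto (fun ε : ℝ => ENNReal.ofReal (n * (α + 2 * ε))) (𝓝 0)
        (𝓝 (ENNReal.ofReal (n * (α + 2 * 0)))) := by
      exact (ENNReal.continuous_ofReal.comp (by fun_prop)).tendsto 0
    rw [mul_zero, add_zero] at this
    exact this.mono_left nhdsWithin_le_nhds
  refine ge_of_tendsto hlim ?_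
  filter_upwards [Ioo_mem_nhdsGT hε₀] with ε hε using key ε hε.1 hε.2

/-! ### Cantor sets parametrised by binary digits -/

/-- The point `∑ a_i c^(i+1)` of the Cantor set of ratio `c` with binary digits `a`. -/
noncomputable def cantorPoint (c : ℝ) (a : ℕ → Fin 2) : ℝ := ∑' i, ((a i : ℕ) : ℝ) * c ^ (i + 1)

theorem fin_two_cast_le_one (x : Fin 2) : ((x : ℕ) : ℝ) ≤ 1 := by
  exact_mod_cast Nat.lt_succ_iff.1 x.2

section

variable {c : ℝ}

theorem summable_geometric_succ (hc : 0 < c) (hc' : c ≤ 1 / 2) :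
    Summable fun i : ℕ => c ^ (i + 1) :=
  (summable_nat_add_iff 1).2 (summable_geometric_of_lt_one hc.le (by linarith))

theorem summable_cantorPoint (hc : 0 < c) (hc' : c ≤ 1 / 2) (a : ℕ → Fin 2) :
    Summable fun i => ((a i : ℕ) : ℝ) * c ^ (i + 1) :=
  Summable.of_nonneg_of_le (fun _ => by positivity)
    (fun i => mul_le_of_le_one_left (by positivity) (fin_two_cast_le_one _))
    (summable_geometric_succ hc hc')

theorem cantorPoint_nonneg (hc : 0 < c) (a : ℕ → Fin 2) : 0 ≤ cantorPoint c a :=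
  tsum_nonneg fun _ => by positivity

theorem cantorPoint_le (hc : 0 < c) (hc' : c ≤ 1 / 2) (a : ℕ → Fin 2) :
    cantorPoint c a ≤ c / (1 - c) := by
  have h : ∑' i : ℕ, c ^ (i + 1) = c / (1 - c) := by
    simp_rw [pow_succ']
    rw [tsum_mul_left, tsum_geometric_of_lt_one hc.le (by linarith)]
    rfl
  rw [← h]
  exact Summable.tsum_le_tsum
    (fun i => mul_le_of_le_one_left (by positivity) (fin_two_cast_le_one _))
    (summable_cantorPoint hc hc' a) (summable_geometric_succ hc hc')

theorem cantorPoint_le_one (hc : 0 < c) (hc' : c ≤ 1 / 2) (a : ℕ → Fin 2) :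
    cantorPoint c a ≤ 1 :=
  (cantorPoint_le hc hc' a).trans (by rw [div_le_one (by linarith)]; linarith)

theorem cantorPoint_eq_sum_add (hc : 0 < c) (hc' : c ≤ 1 / 2) (a : ℕ → Fin 2) (m : ℕ) :
    cantorPoint c a = ∑ i ∈ Finset.range m, ((a i : ℕ) : ℝ) * c ^ (i + 1) +
      c ^ m * cantorPoint c fun i => a (i + m) := by
  rw [cantorPoint, ← (summable_cantorPoint hc hc' a).sum_add_tsum_nat_add m, cantorPoint,
    ← tsum_mul_left]
  congr 2
  ext i
  ring

theorem cantorPoint_sub_of_agree (hc : 0 < c) (hc' : c ≤ 1 / 2) {a b : ℕ → Fin 2} {m : ℕ}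
    (h : ∀ i < m, a i = b i) : cantorPoint c a - cantorPoint c b =
      c ^ m * (cantorPoint c (fun i => a (i + m)) - cantorPoint c fun i => b (i + m)) := by
  rw [cantorPoint_eq_sum_add hc hc' a m, cantorPoint_eq_sum_add hc hc' b m,
    Finset.sum_congr rfl fun i hi => by rw [h i (Finset.mem_range.1 hi)]]
  ring

theorem abs_cantorPoint_sub_le (hc : 0 < c) (hc' : c ≤ 1 / 2) {a b : ℕ → Fin 2} {m : ℕ}
    (h : ∀ i < m, a i = b i) : |cantorPoint c a - cantorPoint c b| ≤ c ^ m := by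
  rw [cantorPoint_sub_of_agree hc hc' h, abs_mul, abs_of_nonneg (by positivity)]
  refine mul_le_of_le_one_right (by positivity) (abs_le.2 ⟨?_, ?_⟩) <;>
    linarith [cantorPoint_nonneg hc fun i => a (i + m), cantorPoint_nonneg hc fun i => b (i + m),
      cantorPoint_le_one hc hc' fun i => a (i + m), cantorPoint_le_one hc hc' fun i => b (i + m)]

/-- After factoring out `c ^ m`, the first differing digit contributes `c`, while the later digits
cancel at most `c * (c / (1 - c))` of it. The resulting gap vanishes at `c = 1 / 2`, so the estimate
is useful only for `c < 1 / 2`. -/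
theorem le_abs_cantorPoint_sub (hc : 0 < c) (hc' : c ≤ 1 / 2) {a b : ℕ → Fin 2} {m : ℕ}
    (h : ∀ i < m, a i = b i) (hm : a m ≠ b m) :
    c ^ m * (c * (1 - c / (1 - c))) ≤ |cantorPoint c a - cantorPoint c b| := by
  rw [cantorPoint_sub_of_agree hc hc' h, abs_mul, abs_of_nonneg (a := c ^ m) (by positivity)]
  refine mul_le_mul_of_nonneg_left ?_ (by positivity)
  rw [cantorPoint_eq_sum_add hc hc' (fun i => a (i + m)) 1,
    cantorPoint_eq_sum_add hc hc' (fun i => b (i + m)) 1]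
  simp only [Finset.sum_range_one, zero_add, pow_one]
  set A := cantorPoint c fun i => a (i + 1 + m)
  set B := cantorPoint c fun i => b (i + 1 + m)
  have hA : 0 ≤ A := cantorPoint_nonneg hc _
  have hB : 0 ≤ B := cantorPoint_nonneg hc _
  have hA' : A ≤ c / (1 - c) := cantorPoint_le hc hc' _
  have hB' : B ≤ c / (1 - c) := cantorPoint_le hc hc' _
  have hab : (((a m : ℕ) : ℝ) = 0 ∧ ((b m : ℕ) : ℝ) = 1) ∨
      (((a m : ℕ) : ℝ) = 1 ∧ ((b m : ℕ) : ℝ) = 0) := by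
    generalize a m = x at hm ⊢
    generalize b m = y at hm ⊢
    fin_cases x <;> fin_cases y <;> simp_all
  rcases hab with ⟨h1, h2⟩ | ⟨h1, h2⟩ <;> rw [h1, h2]
  · rw [abs_sub_comm]
    refine le_trans ?_ (le_abs_self _)
    nlinarith
  · refine le_trans ?_ (le_abs_self _)
    nlinarith

theorem continuous_cantorPoint (hc : 0 < c) (hc' : c ≤ 1 / 2) : Continuous (cantorPoint c) := by
  refine continuous_tsum (fun i => by fun_prop) (summable_geometric_succ hc hc') fun i a => ?_
  rw [Real.norm_of_nonneg (by positivity)]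
  exact mul_le_of_le_one_left (by positivity) (fin_two_cast_le_one _)

theorem cantorPoint_half (a : ℕ → Fin 2) : cantorPoint (1 / 2) a = Real.ofDigits a := by
  simp [cantorPoint, Real.ofDigits, Real.ofDigitsTerm]

theorem eq_of_forall_agree {a b : ℕ → Fin 2} : a = b ∨ ∃ m, (∀ i < m, a i = b i) ∧ a m ≠ b m := by
  by_cases h : a = b
  · exact .inl h
  · have : ∃ m, a m ≠ b m := Function.ne_iff.1 h
    classical
    exact .inr ⟨Nat.find this, fun i hi => not_not.1 (Nat.find_min this hi), Nat.find_spec this⟩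

end

/-! ### Lower bounds for dimension through the digit map -/

/-- The digit map from the Cantor set of ratio `2^(-1/s)` onto the unit interval is `s`-Hölder. -/
theorem exists_abs_ofDigits_sub_le {s : ℝ} (hs : 0 < s) (hs' : s ≤ 1) :
    ∃ K : ℝ, 0 < K ∧ ∀ a b : ℕ → Fin 2, |Real.ofDigits a - Real.ofDigits b| ≤
      K * |cantorPoint ((1 / 2) ^ (1 / s)) a - cantorPoint ((1 / 2) ^ (1 / s)) b| ^ s := by
  -- For `s = 1` the ratio is `1 / 2` and the separation estimate degenerates, but the Cantor point
  -- is then the binary expansion itself.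
  rcases hs'.lt_or_eq with hlt | rfl
  · set c : ℝ := (1 / 2) ^ (1 / s) with hc
    have hc0 : 0 < c := by positivity
    have hc1 : c < 1 / 2 := by
      have := Real.rpow_lt_rpow_of_exponent_gt (x := 1 / 2) (by norm_num) (by norm_num)
        (one_lt_one_div hs hlt)
      rwa [Real.rpow_one] at this
    have hcs : c ^ s = 1 / 2 := by
      rw [hc, ← Real.rpow_mul (by norm_num), one_div_mul_cancel hs.ne', Real.rpow_one]
    set κ : ℝ := c * (1 - c / (1 - c)) with hκ
    have hκ0 : 0 < κ := by
      refine mul_pos hc0 (sub_pos.2 ?_)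
      rw [div_lt_one (by linarith)]
      linarith
    refine ⟨κ⁻¹ ^ s, by positivity, fun a b => ?_⟩
    rcases eq_of_forall_agree (a := a) (b := b) with rfl | ⟨m, hm, hm'⟩
    · simp [Real.zero_rpow hs.ne']
    · calc _ ≤ (((2 : ℕ) : ℝ) ^ m)⁻¹ := Real.abs_ofDigits_sub_ofDigits_le hm
        _ = (c ^ m) ^ s := by
          rw [← Real.rpow_natCast c, ← Real.rpow_mul hc0.le, mul_comm, Real.rpow_mul hc0.le, hcs]
          simp
        _ = κ⁻¹ ^ s * (c ^ m * κ) ^ s := by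
          rw [← Real.mul_rpow (by positivity) (by positivity)]
          congr 1
          field_simp
        _ ≤ _ := by
          gcongr
          exact le_abs_cantorPoint_sub hc0 hc1.le hm hm'
  · exact ⟨1, one_pos, fun a b => by simp [← cantorPoint_half]⟩

/-- If `Q` is Hölder in terms of `P`, then the range of `Q` is at most `1/r` times as large as the
range of `P`. -/
theorem dimH_range_le_of_holder {Ω X Y : Type*} [MetricSpace X] [MetricSpace Y] {P : Ω → X}
    {Q : Ω → Y} {K : ℝ} {r : NNReal} (hr : 0 < r)
    (h : ∀ a b, dist (Q a) (Q b) ≤ K * dist (P a) (P b) ^ (r : ℝ)) :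
    dimH (Set.range Q) ≤ dimH (Set.range P) / r := by
  rcases isEmpty_or_nonempty Ω with hΩ | hΩ
  · simp [Set.range_eq_empty]
  -- The Hölder bound forces `Q` to be constant on the fibres of `P`, so `Q` factors through `P`
  -- even if `P` is not injective.
  have hQ : ∀ a, Q (Function.invFun P (P a)) = Q a := fun a => by
    have h1 := h (Function.invFun P (P a)) a
    rw [Function.invFun_eq (f := P) ⟨a, rfl⟩, dist_self, Real.zero_rpow (by positivity), mul_zero] at h1
    exact dist_le_zero.1 h1
  have himg : Set.range Q = (Q ∘ Function.invFun P) '' Set.range P := by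
    rw [← Set.range_comp]
    congr 1
    ext a
    exact (hQ a).symm
  rw [himg]
  refine HolderOnWith.dimH_image_le (C := K.toNNReal) ?_ hr
  rintro _ ⟨a, rfl⟩ _ ⟨b, rfl⟩
  simp only [Function.comp, hQ]
  rw [edist_dist, edist_dist, ENNReal.ofReal_rpow_of_nonneg dist_nonneg (by positivity),
    ← ENNReal.ofReal_coe_nnreal, ← ENNReal.ofReal_mul (by positivity)]
  refine ENNReal.ofReal_le_ofReal ((h a b).trans ?_)
  gcongr
  exact Real.le_coe_toNNReal K

/-- A set parametrised by the `ι`-th power of the Cantor set of dimension `s`, with Lipschitz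
inverse, has Hausdorff dimension at least `s * |ι|`. -/
theorem le_dimH_range_of_cantorPoint {ι X : Type*} [Fintype ι] [MetricSpace X] {s : ℝ}
    (hs : 0 < s) (hs' : s ≤ 1) {P : (ι → ℕ → Fin 2) → X} {K : ℝ} (hK : 0 ≤ K)
    (hP : ∀ a b : ι → ℕ → Fin 2, ∀ i, |cantorPoint ((1 / 2) ^ (1 / s)) (a i) -
      cantorPoint ((1 / 2) ^ (1 / s)) (b i)| ≤ K * dist (P a) (P b)) :
    ENNReal.ofReal (s * Fintype.card ι) ≤ dimH (Set.range P) := by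
  obtain ⟨L, hL, hol⟩ := exists_abs_ofDigits_sub_le hs hs'
  have hr : 0 < s.toNNReal := Real.toNNReal_pos.2 hs
  have h := dimH_range_le_of_holder (P := P)
    (Q := fun a : ι → ℕ → Fin 2 => fun i => Real.ofDigits (a i)) (K := L * K ^ s) hr (by
      intro a b
      rw [Real.coe_toNNReal _ hs.le, dist_pi_le_iff (by positivity), mul_assoc,
        ← Real.mul_rpow hK dist_nonneg]
      intro i
      rw [Real.dist_eq]
      refine (hol _ _).trans ?_
      gcongr
      exact hP a b i)
  -- Binary expansions fill the unit cube, of dimension `card ι`; an open ball inside it is enough.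
  have hcube : Metric.ball (fun _ : ι => (1 / 2 : ℝ)) (1 / 2) ⊆
      Set.range (fun a : ι → ℕ → Fin 2 => fun i => Real.ofDigits (a i)) := by
    intro y hy
    have hy' : ∀ i, ∃ a : ℕ → Fin 2, Real.ofDigits a = y i := by
      intro i
      rw [Metric.mem_ball, dist_pi_lt_iff (by norm_num)] at hy
      have h2 := abs_lt.1 (hy i)
      obtain ⟨a, -, ha⟩ := Real.ofDigits_SurjOn (b := 2) one_lt_two
        (show y i ∈ Set.Icc (0 : ℝ) 1 from ⟨by linarith, by linarith⟩)
      exact ⟨a, ha⟩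
    choose a ha using hy'
    exact ⟨a, funext ha⟩
  have h3 := (dimH_mono hcube).trans h
  rw [Real.dimH_ball_pi _ (by norm_num), ENNReal.le_div_iff_mul_le (by simp [hs]) (by simp)] at h3
  rw [mul_comm, ENNReal.ofReal_mul (by positivity), ENNReal.ofReal_natCast]
  exact h3

/-! ### Volume regularity of Cantor-type sets -/

/-- `E` is `α`-regular from above at the scales `δ i`, in terms of the volume of its
neighbourhoods. -/
def VolumeRegular {d : ℕ} (α : ℝ) (δ : ℕ → ℝ) (E : Set (EuclideanSpace ℝ (Fin d))) : Prop :=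
  ∃ C : ℝ, 0 < C ∧ ∀ (i : ℕ) (x : EuclideanSpace ℝ (Fin d)) (r : ℝ), δ i ≤ r →
    volume (Metric.thickening (δ i) E ∩ Metric.ball x r) ≤
      ENNReal.ofReal (C * ((r / δ i) ^ α * δ i ^ d))

namespace VolumeRegular

variable {d : ℕ} {α : ℝ} {δ : ℕ → ℝ}

/-- Since `r / δ i ≥ 1` and `δ i ≤ 1`, inserting `ε` in either exponent only enlarges the bound, so
one constant serves all `ε`. -/
theorem isDiscreteRegular {E : Set (EuclideanSpace ℝ (Fin d))} (hδ : ∀ i, 0 < δ i)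
    (hδ1 : ∀ i, δ i ≤ 1) (hδ0 : Tendsto δ atTop (𝓝 0)) (h : VolumeRegular α δ E) :
    IsDiscreteRegular α E := by
  obtain ⟨C, hC, hvol⟩ := h
  refine ⟨δ, hδ, hδ0, 1, one_pos, fun ε hε _ => ⟨C, hC, fun i x r hr => ?_⟩⟩
  refine (hvol i x r hr).trans (ENNReal.ofReal_le_ofReal ?_)
  have hpos := hδ i
  have h1 : 1 ≤ r / δ i := (one_le_div hpos).2 hr
  have h2 : δ i ^ d ≤ δ i ^ ((d : ℝ) - ε) := by
    rw [← Real.rpow_natCast]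
    exact Real.rpow_le_rpow_of_exponent_ge hpos (hδ1 i) (by linarith)
  have h3 : (r / δ i) ^ α ≤ (r / δ i) ^ (α + ε) :=
    Real.rpow_le_rpow_of_exponent_le h1 (by linarith)
  gcongr

theorem union {E F : Set (EuclideanSpace ℝ (Fin d))} (hδ : ∀ i, 0 < δ i)
    (hE : VolumeRegular α δ E) (hF : VolumeRegular α δ F) : VolumeRegular α δ (E ∪ F) := by
  obtain ⟨C, hC, hvol⟩ := hE
  obtain ⟨D, hD, hvol'⟩ := hF
  refine ⟨C + D, add_pos hC hD, fun i x r hr => ?_⟩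
  have hpos := hδ i
  have hrpos : 0 < r := hpos.trans_le hr
  rw [Metric.thickening_union, Set.union_inter_distrib_right, add_mul,
    ENNReal.ofReal_add (by positivity) (by positivity)]
  exact (measure_union_le _ _).trans (add_le_add (hvol i x r hr) (hvol' i x r hr))

theorem empty : VolumeRegular α δ (∅ : Set (EuclideanSpace ℝ (Fin d))) :=
  ⟨1, one_pos, fun i x r _ => by simp⟩

theorem iUnion {J : Type*} [Finite J] {E : J → Set (EuclideanSpace ℝ (Fin d))}
    (hδ : ∀ i, 0 < δ i) (hE : ∀ j, VolumeRegular α δ (E j)) :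
    VolumeRegular α δ (⋃ j, E j) := by
  cases nonempty_fintype J
  have : ∀ S : Finset J, VolumeRegular α δ (⋃ j ∈ S, E j) := by
    classical
    intro S
    induction S using Finset.induction_on with
    | empty => simpa using empty
    | insert j S _ ih =>
      rw [Finset.set_biUnion_insert]
      exact (hE j).union hδ ih
  simpa using this Finset.univ

theorem singleton (hα : 0 < α) (hδ : ∀ i, 0 < δ i) (x₀ : EuclideanSpace ℝ (Fin d)) :
    VolumeRegular α δ {x₀} := by
  set V : ℝ := volume.real (Metric.ball (0 : EuclideanSpace ℝ (Fin d)) 1) with hV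
  have hVpos : 0 < V :=
    ENNReal.toReal_pos (Metric.measure_ball_pos volume _ one_pos).ne' measure_ball_lt_top.ne
  have hVof : volume (Metric.ball (0 : EuclideanSpace ℝ (Fin d)) 1) = ENNReal.ofReal V :=
    (ENNReal.ofReal_toReal measure_ball_lt_top.ne).symm
  refine ⟨V, hVpos, fun i x r hr => ?_⟩
  have hpos := hδ i
  refine (measure_mono Set.inter_subset_left).trans ?_
  rw [Metric.thickening_singleton, Measure.addHaar_ball_of_pos _ _ hpos,
    finrank_euclideanSpace_fin, hVof, ← ENNReal.ofReal_mul (by positivity)]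
  apply ENNReal.ofReal_le_ofReal
  rw [mul_comm]
  gcongr
  exact le_mul_of_one_le_left (by positivity)
    (Real.one_le_rpow ((one_le_div hpos).2 hr) hα.le)

end VolumeRegular

/-- The integer with binary digits `a 0, …, a (N - 1)`, the leading one first. -/
def binaryCode (a : ℕ → Fin 2) : ℕ → ℕ
  | 0 => 0
  | N + 1 => 2 * binaryCode a N + a N

theorem binaryCode_eq (a : ℕ → Fin 2) (N : ℕ) :
    (binaryCode a N : ℝ) = 2 ^ N * ∑ i ∈ Finset.range N, Real.ofDigitsTerm a i := by
  induction N with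
  | zero => simp [binaryCode]
  | succ N ih =>
    rw [Finset.sum_range_succ, mul_add, pow_succ', mul_assoc, ← ih, binaryCode]
    simp only [Real.ofDigitsTerm]
    push_cast
    field_simp
    ring

theorem agree_of_binaryCode_eq {a b : ℕ → Fin 2} {N : ℕ} (h : binaryCode a N = binaryCode b N) :
    ∀ i < N, a i = b i := by
  induction N with
  | zero => intro i hi; omega
  | succ N ih =>
    have ha := (a N).2
    have hb := (b N).2
    simp only [binaryCode] at h
    intro i hi
    rcases Nat.lt_succ_iff_lt_or_eq.1 hi with hi | rfl
    · exact ih (by omega) i hi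
    · exact Fin.ext (by omega)

/-- The sequence of digits that continues `f` by zeros. -/
def zeroExtend {N : ℕ} (f : Fin N → Fin 2) (j : ℕ) : Fin 2 := if h : j < N then f ⟨j, h⟩ else 0

/-- Truncated expansions become integers after scaling by `2 ^ N`, so counting nearby points becomes
counting integers in an interval. -/
theorem ofDigits_zeroExtend {N : ℕ} (f : Fin N → Fin 2) :
    2 ^ N * Real.ofDigits (zeroExtend f) = binaryCode (zeroExtend f) N := by
  have h : Real.ofDigits (fun i => zeroExtend f (i + N)) = 0 := by
    simp [zeroExtend, Real.ofDigits, Real.ofDigitsTerm]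
  rw [binaryCode_eq, Real.ofDigits_eq_sum_add_ofDigits _ N, h, mul_zero, add_zero]

section

variable {d : ℕ} {ι : Type*} [Fintype ι] {c K : ℝ}
  {P : (ι → ℕ → Fin 2) → EuclideanSpace ℝ (Fin d)}

theorem continuous_of_dist_le_cantorPoint (hc : 0 < c) (hc' : c ≤ 1 / 2)
    (hP' : ∀ a b : ι → ℕ → Fin 2, dist (P a) (P b) ≤
      K * dist (fun i => cantorPoint c (a i)) (fun i => cantorPoint c (b i))) :
    Continuous P := by
  rw [continuous_iff_continuousAt]
  intro a
  rw [ContinuousAt, tendsto_iff_dist_tendsto_zero]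
  have hcont : Continuous fun b : ι → ℕ → Fin 2 =>
      K * dist (fun i => cantorPoint c (b i)) (fun i => cantorPoint c (a i)) := by
    have := continuous_cantorPoint hc hc'
    fun_prop
  have h0 := hcont.tendsto a
  rw [dist_self, mul_zero] at h0
  exact squeeze_zero (fun _ => dist_nonneg) (fun b => hP' b a) h0

/-- The number of truncated digit families whose points lie in a given ball. -/
theorem card_zeroExtend_mem_ball_le {s : ℝ} (hs : 0 < s) (hs' : s ≤ 1) (hK : 0 ≤ K)
    (hP : ∀ a b : ι → ℕ → Fin 2, ∀ i, |cantorPoint ((1 / 2) ^ (1 / s)) (a i) -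
      cantorPoint ((1 / 2) ^ (1 / s)) (b i)| ≤ K * dist (P a) (P b)) :
    ∃ A : ℝ, 0 ≤ A ∧ ∀ (N : ℕ) (x : EuclideanSpace ℝ (Fin d)) (r : ℝ) (S : Finset (ι → Fin N → Fin 2)),
      0 ≤ r → (∀ f ∈ S, dist (P fun i => zeroExtend (f i)) x ≤ r) →
        (S.card : ℝ) ≤ (2 * (A * (2 ^ N * r ^ s)) + 1) ^ Fintype.card ι := by
  classical
  obtain ⟨H, hH, hol⟩ := exists_abs_ofDigits_sub_le hs hs'
  refine ⟨H * (2 * K) ^ s, by positivity, fun N x r S hr hS => ?_⟩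
  rcases S.eq_empty_or_nonempty with rfl | ⟨g, hg⟩
  · simp only [Finset.card_empty, Nat.cast_zero]
    positivity
  set B : ℝ := H * (2 * K) ^ s * (2 ^ N * r ^ s) with hB
  have hB0 : 0 ≤ B := by positivity
  set z : (ι → Fin N → Fin 2) → ι → ℤ := fun f i => (binaryCode (zeroExtend (f i)) N : ℤ) with hz
  have hclose : ∀ f ∈ S, ∀ i, |(z f i : ℝ) - z g i| ≤ B := by
    intro f hf i
    have h1 : (z f i : ℝ) - z g i = 2 ^ N *
        (Real.ofDigits (zeroExtend (f i)) - Real.ofDigits (zeroExtend (g i))) := by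
      rw [mul_sub, ofDigits_zeroExtend, ofDigits_zeroExtend]
      simp [hz]
    rw [h1, abs_mul, abs_of_pos (by positivity), hB]
    calc _ ≤ 2 ^ N * (H * (K * (r + r)) ^ s) := by
          gcongr
          refine (hol _ _).trans ?_
          gcongr
          refine (hP (fun i => zeroExtend (f i)) (fun i => zeroExtend (g i)) i).trans ?_
          gcongr
          exact (dist_triangle_right _ _ x).trans (add_le_add (hS f hf) (hS g hg))
      _ = _ := by
          rw [← two_mul, ← mul_assoc K, mul_comm K 2, Real.mul_rpow (by positivity) hr]
          ring
  -- The integer codes determine the digit families, and all lie in a box about the code of the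
  -- fixed member `g`.
  have hcard : S.card ≤ (Fintype.piFinset fun i => Finset.Icc (z g i - ⌊B⌋) (z g i + ⌊B⌋)).card := by
    refine Finset.card_le_card_of_injOn z ?_ ?_
    · intro f hf
      rw [Finset.mem_coe, Fintype.mem_piFinset]
      intro i
      have h1 := abs_le.1 (hclose f hf i)
      rw [Finset.mem_Icc]
      have h2 : z g i - z f i ≤ ⌊B⌋ := Int.le_floor.2 (by push_cast; linarith)
      have h3 : z f i - z g i ≤ ⌊B⌋ := Int.le_floor.2 (by push_cast; linarith)
      constructor <;> linarith
    · intro f _ f' _ hff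
      funext i j
      have h1 : binaryCode (zeroExtend (f i)) N = binaryCode (zeroExtend (f' i)) N := by
        exact Int.ofNat_inj.1 (congrFun hff i)
      simpa [zeroExtend] using agree_of_binaryCode_eq h1 j j.2
  have hfl : 0 ≤ ⌊B⌋ := Int.floor_nonneg.2 hB0
  rw [Fintype.card_piFinset] at hcard
  have h4 : ∀ i, (Finset.Icc (z g i - ⌊B⌋) (z g i + ⌊B⌋)).card = (2 * ⌊B⌋ + 1).toNat := by
    intro i
    rw [Int.card_Icc]
    congr 1
    ring
  simp only [h4, Finset.prod_const, Finset.card_univ] at hcard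
  have h5 : (((2 * ⌊B⌋ + 1).toNat : ℕ) : ℝ) = 2 * (⌊B⌋ : ℝ) + 1 := by
    have : (((2 * ⌊B⌋ + 1).toNat : ℕ) : ℤ) = 2 * ⌊B⌋ + 1 := Int.toNat_of_nonneg (by linarith)
    exact_mod_cast this
  calc (S.card : ℝ) ≤ (((2 * ⌊B⌋ + 1).toNat ^ Fintype.card ι : ℕ) : ℝ) := by exact_mod_cast hcard
    _ = (2 * (⌊B⌋ : ℝ) + 1) ^ Fintype.card ι := by rw [Nat.cast_pow, h5]
    _ ≤ _ := by
      gcongr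
      exact Int.floor_le B

/-- A bi-Lipschitz image of the `ι`-th power of the Cantor set of dimension `s` is regular of
dimension `s * |ι|`. -/
theorem volumeRegular_range_of_cantorPoint {s : ℝ} (hs : 0 < s) (hs' : s ≤ 1) (hK : 0 ≤ K)
    (hP : ∀ a b : ι → ℕ → Fin 2, ∀ i, |cantorPoint ((1 / 2) ^ (1 / s)) (a i) -
      cantorPoint ((1 / 2) ^ (1 / s)) (b i)| ≤ K * dist (P a) (P b))
    (hP' : ∀ a b : ι → ℕ → Fin 2, dist (P a) (P b) ≤
      K * dist (fun i => cantorPoint ((1 / 2) ^ (1 / s)) (a i))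
        (fun i => cantorPoint ((1 / 2) ^ (1 / s)) (b i))) :
    VolumeRegular (s * Fintype.card ι) (fun N => ((1 / 2 : ℝ) ^ (1 / s)) ^ N) (Set.range P) := by
  classical
  obtain ⟨A, hA, hcard⟩ := card_zeroExtend_mem_ball_le hs hs' hK hP
  set c : ℝ := (1 / 2) ^ (1 / s) with hc
  have hc0 : 0 < c := by positivity
  have hc1 : c ≤ 1 / 2 := by
    have := Real.rpow_le_rpow_of_exponent_ge (x := 1 / 2) (by norm_num) (by norm_num)
      ((one_le_div hs).2 hs')
    rwa [Real.rpow_one] at this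
  have hcs : c ^ s = 1 / 2 := by
    rw [hc, ← Real.rpow_mul (by norm_num), one_div_mul_cancel hs.ne', Real.rpow_one]
  set V : ℝ := volume.real (Metric.ball (0 : EuclideanSpace ℝ (Fin d)) 1) with hV
  have hVpos : 0 < V :=
    ENNReal.toReal_pos (Metric.measure_ball_pos volume _ one_pos).ne' measure_ball_lt_top.ne
  have hVof : volume (Metric.ball (0 : EuclideanSpace ℝ (Fin d)) 1) = ENNReal.ofReal V :=
    (ENNReal.ofReal_toReal measure_ball_lt_top.ne).symm
  set m := Fintype.card ι
  refine ⟨(2 * (A * (2 + K) ^ s) + 1) ^ m * ((1 + K) ^ d * V), by positivity,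
    fun N x r hr => ?_⟩
  simp only at hr ⊢
  set δ : ℝ := c ^ N with hδ
  have hδ0 : 0 < δ := by positivity
  have hr0 : 0 < r := hδ0.trans_le hr
  -- Truncation moves a point by at most `K * δ`. A point of the neighbourhood within `r` of `x` is
  -- thus within `(1 + K) * δ` of a truncated point, which lies within `(2 + K) * r` of `x` because
  -- `δ ≤ r`.
  set S : Finset (ι → Fin N → Fin 2) :=
    Finset.univ.filter fun f => dist (P fun i => zeroExtend (f i)) x ≤ (2 + K) * r with hS
  have hsub : Metric.thickening δ (Set.range P) ∩ Metric.ball x r ⊆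
      ⋃ f ∈ S, Metric.ball (P fun i => zeroExtend (f i)) ((1 + K) * δ) := by
    rintro y ⟨hy, hyx⟩
    obtain ⟨_, ⟨a, rfl⟩, hya⟩ := Metric.mem_thickening_iff.1 hy
    rw [Metric.mem_ball] at hyx
    set f : ι → Fin N → Fin 2 := fun i j => a i j with hf
    have h1 : dist (P a) (P fun i => zeroExtend (f i)) ≤ K * δ := by
      refine (hP' _ _).trans ?_
      gcongr
      rw [dist_pi_le_iff hδ0.le]
      intro i
      rw [Real.dist_eq]
      exact abs_cantorPoint_sub_le hc0 hc1 fun j hj => by simp [zeroExtend, hf, hj]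
    have h2 : dist y (P fun i => zeroExtend (f i)) < (1 + K) * δ := by
      linarith [dist_triangle y (P a) (P fun i => zeroExtend (f i))]
    refine Set.mem_iUnion₂.2 ⟨f, ?_, h2⟩
    rw [hS, Finset.mem_filter]
    refine ⟨Finset.mem_univ _, ?_⟩
    have h3 : (1 + K) * δ ≤ (1 + K) * r := by gcongr
    linarith [dist_triangle_left (P fun i => zeroExtend (f i)) x y]
  have hSc := hcard N x ((2 + K) * r) S (by positivity)
    fun f hf => (Finset.mem_filter.1 hf).2
  have hδs : (2 : ℝ) ^ N = (δ ^ s)⁻¹ := by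
    rw [hδ, ← Real.rpow_natCast c, ← Real.rpow_mul hc0.le, mul_comm, Real.rpow_mul hc0.le, hcs]
    simp
  -- This absorbs the additive `1` in the counting bound.
  have hratio : 1 ≤ (r / δ) ^ s := Real.one_le_rpow ((one_le_div hδ0).2 hr) hs.le
  have hSc' : (S.card : ℝ) ≤ (2 * (A * (2 + K) ^ s) + 1) ^ m * (r / δ) ^ (s * m) := by
    refine hSc.trans ?_
    rw [Real.rpow_mul (by positivity), Real.rpow_natCast, ← mul_pow]
    gcongr
    rw [hδs, Real.mul_rpow (by positivity) hr0.le]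
    have : (δ ^ s)⁻¹ * ((2 + K) ^ s * r ^ s) = (2 + K) ^ s * (r / δ) ^ s := by
      rw [Real.div_rpow hr0.le hδ0.le]
      field_simp
    rw [this, add_mul]
    linarith
  calc _ ≤ ∑ f ∈ S, volume (Metric.ball (P fun i => zeroExtend (f i)) ((1 + K) * δ)) :=
        (measure_mono hsub).trans (measure_biUnion_finset_le _ _)
    _ = ENNReal.ofReal (S.card * (((1 + K) * δ) ^ d * V)) := by
        simp only [Measure.addHaar_ball_of_pos volume _ (show 0 < (1 + K) * δ by positivity),
          finrank_euclideanSpace_fin, hVof, Finset.sum_const, nsmul_eq_mul]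
        rw [ENNReal.ofReal_mul (by positivity), ENNReal.ofReal_natCast,
          ENNReal.ofReal_mul (by positivity)]
    _ ≤ _ := by
        apply ENNReal.ofReal_le_ofReal
        rw [mul_pow]
        calc _ ≤ (2 * (A * (2 + K) ^ s) + 1) ^ m * (r / δ) ^ (s * m) *
              ((1 + K) ^ d * δ ^ d * V) := by gcongr
          _ = _ := by ring

end

/-! ### Cantor patches on spheres -/

theorem abs_sqrt_sub_sqrt_le {x y : ℝ} (hx : 1 / 4 ≤ x) (hy : 1 / 4 ≤ y) :
    |√x - √y| ≤ |x - y| := by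
  have h1 : 1 / 2 ≤ √x := Real.le_sqrt_of_sq_le (by linarith)
  have h2 : 1 / 2 ≤ √y := Real.le_sqrt_of_sq_le (by linarith)
  have h3 : x - y = (√x - √y) * (√x + √y) := by
    have hx' := Real.mul_self_sqrt (show 0 ≤ x by linarith)
    have hy' := Real.mul_self_sqrt (show 0 ≤ y by linarith)
    linarith
  rw [h3, abs_mul]
  exact le_mul_of_one_le_right (abs_nonneg _) (le_trans (by linarith) (le_abs_self _))

section

variable {ι F : Type*} [Fintype ι] [NormedAddCommGroup F] [InnerProductSpace ℝ F]

/-- The point of the unit sphere whose coordinates along `e (some i)` are `w i`. -/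
noncomputable def sphereGraph (e : Option ι → F) (w : ι → ℝ) : F :=
  ∑ o, (Option.elim o √(1 - ∑ i, w i ^ 2) w : ℝ) • e o

theorem inner_sphereGraph_some {e : Option ι → F} (he : Orthonormal ℝ e) (w : ι → ℝ) (i : ι) :
    inner ℝ (e (some i)) (sphereGraph e w) = w i := by
  rw [sphereGraph, he.inner_right_fintype]
  rfl

theorem norm_sphereGraph {e : Option ι → F} (he : Orthonormal ℝ e) {w : ι → ℝ}
    (hw : ∑ i, w i ^ 2 ≤ 1) : ‖sphereGraph e w‖ = 1 := by
  have h : ‖sphereGraph e w‖ ^ 2 = 1 := by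
    rw [← real_inner_self_eq_norm_sq, sphereGraph, he.inner_sum]
    simp only [Fintype.sum_option, Option.elim, conj_trivial]
    rw [Real.mul_self_sqrt (by linarith)]
    simp [← sq]
  nlinarith [norm_nonneg (sphereGraph e w)]

theorem inner_sphereGraph_eq_zero {e f : Option ι → F} (hef : ∀ o o', inner ℝ (e o) (f o') = 0)
    (v w : ι → ℝ) : inner ℝ (sphereGraph e v) (sphereGraph f w) = 0 := by
  simp only [sphereGraph, sum_inner, inner_sum, inner_smul_left, inner_smul_right, hef, mul_zero,
    Finset.sum_const_zero]

theorem abs_sub_le_dist_sphereGraph {e : Option ι → F} (he : Orthonormal ℝ e) (v w : ι → ℝ)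
    (i : ι) : |v i - w i| ≤ dist (sphereGraph e v) (sphereGraph e w) := by
  rw [← inner_sphereGraph_some he v, ← inner_sphereGraph_some he w, ← inner_sub_right, dist_eq_norm]
  refine (abs_real_inner_le_norm _ _).trans ?_
  rw [he.1, one_mul]

/-- The bound `3 / 4` keeps the radicand at least `1 / 4`, where the square root is 1-Lipschitz; on
`[-1/2, 1/2]` squaring is 1-Lipschitz too. So the `none` coordinate moves no more than the sum of
the others, whence the factor 2. -/
theorem dist_sphereGraph_le {e : Option ι → F} (he : Orthonormal ℝ e) {v w : ι → ℝ}
    (hv : ∑ i, v i ^ 2 ≤ 3 / 4) (hw : ∑ i, w i ^ 2 ≤ 3 / 4)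
    (hv' : ∀ i, |v i| ≤ 1 / 2) (hw' : ∀ i, |w i| ≤ 1 / 2) :
    dist (sphereGraph e v) (sphereGraph e w) ≤ 2 * ∑ i, |v i - w i| := by
  rw [dist_eq_norm, sphereGraph, sphereGraph, ← Finset.sum_sub_distrib]
  simp only [← sub_smul]
  refine (norm_sum_le _ _).trans ?_
  simp only [norm_smul, he.1, mul_one, Fintype.sum_option, Option.elim, Real.norm_eq_abs]
  rw [two_mul]
  gcongr
  refine (abs_sqrt_sub_sqrt_le (by linarith) (by linarith)).trans ?_
  rw [sub_sub_sub_cancel_left, ← Finset.sum_sub_distrib]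
  refine (Finset.abs_sum_le_sum_abs _ _).trans (Finset.sum_le_sum fun i _ => ?_)
  rw [sq_sub_sq, abs_mul, abs_sub_comm (w i)]
  refine mul_le_of_le_one_left (abs_nonneg _) ?_
  exact (abs_add_le _ _).trans (by linarith [hv' i, hw' i])

/-- Bi-Lipschitz copies of the power of a Cantor set on given spheres about the origin, disjoint
if they lie on the same sphere. -/
theorem exists_cantor_sphere_patches [Nonempty ι] {m : ℕ} {c : ℝ} (hc : 0 < c) (hc' : c ≤ 1 / 2)
    {e : Fin m → Option ι → F} (he : ∀ j, Orthonormal ℝ (e j)) {ρ : Fin m → ℝ}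
    (hρ : ∀ j, 0 < ρ j) :
    ∃ K : ℝ, 0 ≤ K ∧ ∃ P : Fin m → (ι → ℕ → Fin 2) → F,
      (∀ j a, ‖P j a‖ = ρ j) ∧
      (∀ j j' a b, (∀ o o', inner ℝ (e j o) (e j' o') = 0) → inner ℝ (P j a) (P j' b) = 0) ∧
      (∀ j a b i, |cantorPoint c (a i) - cantorPoint c (b i)| ≤ K * dist (P j a) (P j b)) ∧
      (∀ j a b, dist (P j a) (P j b) ≤
        K * dist (fun i => cantorPoint c (a i)) (fun i => cantorPoint c (b i))) ∧
      (∀ j j' a b, j ≠ j' → e j = e j' → P j a ≠ P j' b) := by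
  -- Shifting the `j`-th patch by `2 * j` keeps patches with a common frame apart, as Cantor points
  -- lie in `[0, 1]`. Dividing by `M` then makes the coordinates small enough for the graph
  -- estimates.
  set M : ℝ := 2 * (Fintype.card ι + 1) * (2 * m + 1) with hM
  have hM0 : 0 < M := by positivity
  set w : Fin m → (ι → ℕ → Fin 2) → ι → ℝ :=
    fun j a i => (cantorPoint c (a i) + 2 * (j : ℕ)) / M with hw
  have hw0 : ∀ j a i, 0 ≤ w j a i := fun j a i => by
    have := cantorPoint_nonneg hc (a i)
    simp only [hw]
    positivity
  have hw1 : ∀ j a i, w j a i ≤ 1 / (2 * (Fintype.card ι + 1)) := fun j a i => by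
    simp only [hw]
    rw [div_le_div_iff₀ hM0 (by positivity), one_mul, hM, mul_comm]
    refine mul_le_mul_of_nonneg_left ?_ (by positivity)
    have h1 := cantorPoint_le_one hc hc' (a i)
    have h2 : ((j : ℕ) : ℝ) ≤ m := by exact_mod_cast j.2.le
    linarith
  have hcard : (0 : ℝ) ≤ Fintype.card ι := by positivity
  have hhalf : 1 / (2 * ((Fintype.card ι : ℝ) + 1)) ≤ 1 / 2 := by
    apply one_div_le_one_div_of_le <;> linarith
  have hwabs : ∀ j a i, |w j a i| ≤ 1 / 2 := fun j a i => by
    rw [abs_of_nonneg (hw0 j a i)]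
    exact (hw1 j a i).trans hhalf
  have hwsq : ∀ j a, ∑ i, w j a i ^ 2 ≤ 3 / 4 := fun j a => by
    calc ∑ i, w j a i ^ 2 ≤ ∑ _i : ι, 1 / (2 * ((Fintype.card ι : ℝ) + 1)) * (1 / 2) := by
          refine Finset.sum_le_sum fun i _ => ?_
          rw [sq]
          exact mul_le_mul (hw1 j a i) ((hw1 j a i).trans hhalf) (hw0 j a i) (by positivity)
      _ ≤ 3 / 4 := by
          rw [Finset.sum_const, Finset.card_univ, nsmul_eq_mul]
          field_simp
          linarith
  have hdiff : ∀ j a b i, w j a i - w j b i =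
      (cantorPoint c (a i) - cantorPoint c (b i)) / M := fun j a b i => by
    simp only [hw]
    ring
  set K : ℝ := M * ∑ j, (ρ j + (ρ j)⁻¹) with hK
  have hsum : ∀ j, ρ j + (ρ j)⁻¹ ≤ ∑ j, (ρ j + (ρ j)⁻¹) := fun j =>
    Finset.single_le_sum (f := fun j => ρ j + (ρ j)⁻¹)
      (fun j _ => by have := hρ j; positivity) (Finset.mem_univ j)
  have hK1 : ∀ j, M * (ρ j)⁻¹ ≤ K := fun j => by
    rw [hK]
    gcongr
    linarith [hsum j, hρ j]
  have hK2 : ∀ j, M * ρ j ≤ K := fun j => by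
    rw [hK]
    gcongr
    have := inv_pos.2 (hρ j)
    linarith [hsum j]
  have hKn : 0 ≤ K := by
    rw [hK]
    exact mul_nonneg hM0.le (Finset.sum_nonneg fun j _ => by have := hρ j; positivity)
  have hM2 : 2 * (Fintype.card ι : ℝ) ≤ M * M := by
    have : (0 : ℝ) ≤ m := by positivity
    have h1 : 2 * (Fintype.card ι : ℝ) + 2 ≤ M := by rw [hM]; nlinarith
    nlinarith
  have hnorm : ∀ j a, ‖ρ j • sphereGraph (e j) (w j a)‖ = ρ j := fun j a => by
    rw [norm_smul, norm_sphereGraph (he j) (by linarith [hwsq j a]), mul_one,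
      Real.norm_of_nonneg (hρ j).le]
  have hdist : ∀ j a b, dist (ρ j • sphereGraph (e j) (w j a)) (ρ j • sphereGraph (e j) (w j b)) =
      ρ j * dist (sphereGraph (e j) (w j a)) (sphereGraph (e j) (w j b)) := fun j a b => by
    rw [dist_smul₀, Real.norm_of_nonneg (hρ j).le]
  refine ⟨K, hKn, fun j a => ρ j • sphereGraph (e j) (w j a), hnorm, ?_, ?_, ?_, ?_⟩
  · intro j j' a b h
    rw [inner_smul_left, inner_smul_right, inner_sphereGraph_eq_zero h]
    simp
  · intro j a b i
    have h1 := abs_sub_le_dist_sphereGraph (he j) (w j a) (w j b) i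
    rw [hdiff, abs_div, abs_of_pos hM0, div_le_iff₀ hM0] at h1
    refine h1.trans ?_
    simp only [hdist]
    calc _ = M * (ρ j)⁻¹ *
          (ρ j * dist (sphereGraph (e j) (w j a)) (sphereGraph (e j) (w j b))) := by
          have := (hρ j).ne'
          field_simp
      _ ≤ _ := by
          have := hρ j
          gcongr
          exact hK1 j
  · intro j a b
    set D := dist (fun i => cantorPoint c (a i)) (fun i => cantorPoint c (b i)) with hD
    have h1 := dist_sphereGraph_le (he j) (hwsq j a) (hwsq j b) (hwabs j a) (hwabs j b)
    have h2 : ∑ i, |w j a i - w j b i| ≤ Fintype.card ι * (D / M) := by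
      rw [← nsmul_eq_mul, ← Finset.card_univ]
      refine Finset.sum_le_card_nsmul _ _ _ fun i _ => ?_
      rw [hdiff, abs_div, abs_of_pos hM0]
      gcongr
      exact dist_le_pi_dist (fun i => cantorPoint c (a i)) (fun i => cantorPoint c (b i)) i
    have hD0 : 0 ≤ D := dist_nonneg
    simp only [hdist]
    calc _ ≤ ρ j * (2 * (Fintype.card ι * (D / M))) := by
          have := hρ j
          gcongr
          linarith
      _ = ρ j * (2 * Fintype.card ι) * D / M := by ring
      _ ≤ ρ j * (M * M) * D / M := by
          have := hρ j
          gcongr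
      _ = M * ρ j * D := by field_simp
      _ ≤ _ := by
          gcongr
          exact hK2 j
  · intro j j' a b hjj hee heq
    have h1 : ρ j = ρ j' := by
      rw [← hnorm j a, ← hnorm j' b]
      exact congrArg _ heq
    simp only [h1] at heq
    have h2 := smul_right_injective F (hρ j').ne' heq
    obtain ⟨i⟩ := ‹Nonempty ι›
    have h3 : w j a i = w j' b i := by
      rw [← inner_sphereGraph_some (he j) (w j a), ← inner_sphereGraph_some (he j') (w j' b)]
      rw [← hee] at h2 ⊢
      exact congrArg _ h2
    simp only [hw] at h3
    rw [div_left_inj' hM0.ne'] at h3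
    have ha := cantorPoint_nonneg hc (a i)
    have hb := cantorPoint_nonneg hc (b i)
    have ha' := cantorPoint_le_one hc hc' (a i)
    have hb' := cantorPoint_le_one hc hc' (b i)
    rcases lt_or_gt_of_ne (fun h => hjj (Fin.ext h) : (j : ℕ) ≠ j') with h | h
    · have : ((j : ℕ) : ℝ) + 1 ≤ (j' : ℕ) := by exact_mod_cast h
      linarith
    · have : ((j' : ℕ) : ℝ) + 1 ≤ (j : ℕ) := by exact_mod_cast h
      linarith

end

/-! ### Admissible sets and bounds for `chainDim` -/

/-- A finite union of bi-Lipschitz copies of the power of a Cantor set and a finite set is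
admissible in the definition of `chainDim`. -/
theorem admissible_of_cantorPoint {d : ℕ} {ι J : Type*} [Fintype ι] [Nonempty ι] [Finite J]
    [Nonempty J] {s K : ℝ} (hs : 0 < s) (hs' : s ≤ 1) (hK : 0 ≤ K)
    {P : J → (ι → ℕ → Fin 2) → EuclideanSpace ℝ (Fin d)}
    (hP : ∀ j, ∀ a b : ι → ℕ → Fin 2, ∀ i, |cantorPoint ((1 / 2) ^ (1 / s)) (a i) -
      cantorPoint ((1 / 2) ^ (1 / s)) (b i)| ≤ K * dist (P j a) (P j b))
    (hP' : ∀ j, ∀ a b : ι → ℕ → Fin 2, dist (P j a) (P j b) ≤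
      K * dist (fun i => cantorPoint ((1 / 2) ^ (1 / s)) (a i))
        (fun i => cantorPoint ((1 / 2) ^ (1 / s)) (b i)))
    {S : Set (EuclideanSpace ℝ (Fin d))} (hS : S.Finite) {α : ℝ} (hα : α = s * Fintype.card ι) :
    IsCompact ((⋃ j, Set.range (P j)) ∪ S) ∧ IsDiscreteRegular α ((⋃ j, Set.range (P j)) ∪ S) ∧
      dimH ((⋃ j, Set.range (P j)) ∪ S) = ENNReal.ofReal α := by
  have hα0 : 0 < α := by
    have : 0 < Fintype.card ι := Fintype.card_pos
    rw [hα]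
    positivity
  have hc0 : (0 : ℝ) < (1 / 2) ^ (1 / s) := by positivity
  have hc1 : ((1 / 2) ^ (1 / s) : ℝ) ≤ 1 / 2 := by
    have := Real.rpow_le_rpow_of_exponent_ge (x := 1 / 2) (by norm_num) (by norm_num)
      ((one_le_div hs).2 hs')
    rwa [Real.rpow_one] at this
  have hδ : ∀ N : ℕ, (0 : ℝ) < ((1 / 2 : ℝ) ^ (1 / s)) ^ N := fun N => by positivity
  have hcomp : IsCompact ((⋃ j, Set.range (P j)) ∪ S) :=
    (isCompact_iUnion fun j => isCompact_range
      (continuous_of_dist_le_cantorPoint hc0 hc1 (hP' j))).union hS.isCompact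
  have hSreg : VolumeRegular α (fun N => ((1 / 2 : ℝ) ^ (1 / s)) ^ N) S := by
    have := hS.to_subtype
    have h := VolumeRegular.iUnion (E := fun x : S => {(x : EuclideanSpace ℝ (Fin d))}) hδ
      fun x => VolumeRegular.singleton hα0 hδ x.1
    rwa [Set.iUnion_of_singleton_coe] at h
  have hreg : IsDiscreteRegular α ((⋃ j, Set.range (P j)) ∪ S) := by
    refine VolumeRegular.isDiscreteRegular hδ (fun N => pow_le_one₀ hc0.le (by linarith))
      (tendsto_pow_atTop_nhds_zero_of_lt_one hc0.le (by linarith))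
      (VolumeRegular.union hδ (VolumeRegular.iUnion hδ fun j => ?_) hSreg)
    rw [hα]
    exact volumeRegular_range_of_cantorPoint hs hs' hK (hP j) (hP' j)
  refine ⟨hcomp, hreg, le_antisymm ?_ ?_⟩
  · have h := hreg.dimH_pow_le hα0 hcomp 1
    rw [Nat.cast_one, one_mul] at h
    refine le_trans ?_ h
    refine (dimH_mono ?_).trans ((LipschitzWith.eval (α := fun _ : Fin 1 =>
      EuclideanSpace ℝ (Fin d)) 0).dimH_image_le _)
    exact fun x hx => ⟨fun _ => x, fun _ => hx, rfl⟩
  · obtain ⟨j⟩ := ‹Nonempty J›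
    rw [hα]
    refine (le_dimH_range_of_cantorPoint hs hs' hK (hP j)).trans (dimH_mono ?_)
    exact (Set.subset_iUnion (fun j => Set.range (P j)) j).trans Set.subset_union_left

theorem chainDim_le_of_forall {d k : ℕ} {t : Fin k → ℝ} {α : ℝ} {D : ENNReal}
    (h : ∀ E : Set (EuclideanSpace ℝ (Fin d)), IsCompact E → IsDiscreteRegular α E →
      dimH (chainSet t E) ≤ D) : chainDim d t α ≤ D :=
  iSup₂_le fun E hE => h E hE.1 hE.2.1

theorem dimH_chainSet_le_chainDim {d k : ℕ} (t : Fin k → ℝ) {α : ℝ}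
    {E : Set (EuclideanSpace ℝ (Fin d))}
    (hE : IsCompact E ∧ IsDiscreteRegular α E ∧ dimH E = ENNReal.ofReal α) :
    dimH (chainSet t E) ≤ chainDim d t α :=
  le_iSup₂_of_le (f := fun E (_ : E ∈ {E : Set (EuclideanSpace ℝ (Fin d)) |
      IsCompact E ∧ IsDiscreteRegular α E ∧ dimH E = ENNReal.ofReal α}) => dimH (chainSet t E))
    E hE le_rfl

theorem exists_orthonormal_of_card_le {κ : Type*} [Fintype κ] {d : ℕ} (h : Fintype.card κ ≤ d) :
    ∃ e : κ → EuclideanSpace ℝ (Fin d), Orthonormal ℝ e := by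
  obtain ⟨f⟩ := Function.Embedding.nonempty_of_card_le
    (α := κ) (β := Fin d) (by rwa [Fintype.card_fin])
  exact ⟨_, (EuclideanSpace.basisFun (Fin d) ℝ).orthonormal.comp f f.injective⟩

/-! ### Monotone gaps: chains alternating between orthogonal subspaces -/

/-- Radii whose consecutive squares add up to the squares of a nondecreasing sequence of gaps. -/
theorem exists_radii {k : ℕ} (hk : 1 ≤ k) {t : Fin k → ℝ} (ht : ∀ i, 0 < t i) (hm : Monotone t) :
    ∃ ρ : Fin (k + 1) → ℝ, (∀ j, 0 < ρ j) ∧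
      ∀ i : Fin k, ρ i.castSucc ^ 2 + ρ i.succ ^ 2 = t i ^ 2 := by
  set T : ℕ → ℝ := fun i => t ⟨min i (k - 1), by omega⟩ with hT
  have hT0 : ∀ i, 0 < T i := fun i => ht _
  have hTm : ∀ i, T i ^ 2 ≤ T (i + 1) ^ 2 := fun i =>
    pow_le_pow_left₀ (hT0 i).le (hm (by simp only [Fin.mk_le_mk]; omega)) 2
  -- Starting at half of the first squared gap, the recursion `R (i + 1) = T i ^ 2 - R i` preserves
  -- `h ≤ R i ≤ T i ^ 2 - h`. Monotonicity of the gaps is what carries the upper bound to the next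
  -- step.
  set h : ℝ := T 0 ^ 2 / 2 with hh
  have hh0 : 0 < h := by have := hT0 0; positivity
  set R : ℕ → ℝ := fun j => Nat.rec h (fun i r => T i ^ 2 - r) j with hR
  have hRs : ∀ i, R (i + 1) = T i ^ 2 - R i := fun i => rfl
  have hbound : ∀ i, h ≤ R i ∧ R i ≤ T i ^ 2 - h := by
    intro i
    induction i with
    | zero => exact ⟨le_rfl, show h ≤ T 0 ^ 2 - h by rw [hh]; linarith⟩
    | succ i ih =>
      rw [hRs]
      exact ⟨by linarith [ih.2], by linarith [ih.1, hTm i]⟩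
  have hR0 : ∀ i, 0 < R i := fun i => hh0.trans_le (hbound i).1
  refine ⟨fun j => √(R j), fun j => Real.sqrt_pos.2 (hR0 j), fun i => ?_⟩
  have hTi : T i = t i := by
    simp only [hT]
    congr 1
    exact Fin.ext (by simp only; omega)
  simp only [Fin.val_castSucc, Fin.val_succ]
  rw [Real.sq_sqrt (hR0 i).le, Real.sq_sqrt (hR0 (i + 1)).le, hRs, hTi]
  ring

theorem chainDim_eq_of_monotone {k d : ℕ} {α : ℝ} {t : Fin k → ℝ} (hk : 1 ≤ k) (hd : 4 ≤ d)
    (hα : 0 < α) (hαd : α ≤ ((d / 2 : ℕ) : ℝ) - 1) (ht : ∀ i, 0 < t i) (hm : Monotone t) :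
    chainDim d t α = ENNReal.ofReal (((k : ℝ) + 1) * α) := by
  refine le_antisymm (chainDim_le_of_forall fun E hE hr => ?_) ?_
  · refine (dimH_mono fun x hx => hx.1).trans ((hr.dimH_pow_le hα hE (k + 1)).trans_eq ?_)
    push_cast
    rfl
  obtain ⟨n, hn⟩ : ∃ n, d / 2 = n + 1 := ⟨d / 2 - 1, by omega⟩
  have hn0 : n ≠ 0 := by omega
  have : NeZero n := ⟨hn0⟩
  have hnpos : (0 : ℝ) < n := by positivity
  rw [hn] at hαd
  push_cast at hαd
  -- Two mutually orthogonal frames of `n + 1 = ⌊d/2⌋` vectors; the parity of `j` selects the frame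
  -- of the `j`-th patch.
  obtain ⟨E, hE⟩ := exists_orthonormal_of_card_le (κ := Fin 2 × Option (Fin n)) (d := d) (by
    simp only [Fintype.card_prod, Fintype.card_fin, Fintype.card_option]; omega)
  set e : Fin (k + 1) → Option (Fin n) → EuclideanSpace ℝ (Fin d) :=
    fun j o => E (Fin.ofNat 2 j, o) with he
  have hON : ∀ j, Orthonormal ℝ (e j) := fun j => hE.comp _ (Prod.mk_right_injective _)
  have horth : ∀ j j', (Fin.ofNat 2 (j : Fin (k + 1)).val ≠ Fin.ofNat 2 (j' : Fin (k + 1)).val) →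
      ∀ o o', inner ℝ (e j o) (e j' o') = 0 := fun j j' h o o' =>
    hE.2 fun h' => h (congrArg Prod.fst h')
  obtain ⟨ρ, hρ, hρt⟩ := exists_radii hk ht hm
  -- A sphere in dimension `n + 1` has room for `n` Cantor factors, each of dimension `s`; the bound
  -- on `α` says exactly that `s ≤ 1`.
  set s : ℝ := α / n with hs
  have hs0 : 0 < s := by positivity
  have hs1 : s ≤ 1 := by rw [hs, div_le_one hnpos]; linarith
  have hc0 : (0 : ℝ) < (1 / 2) ^ (1 / s) := by positivity
  have hc1 : ((1 / 2) ^ (1 / s) : ℝ) ≤ 1 / 2 := by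
    have := Real.rpow_le_rpow_of_exponent_ge (x := 1 / 2) (by norm_num) (by norm_num)
      ((one_le_div hs0).2 hs1)
    rwa [Real.rpow_one] at this
  obtain ⟨K, hK, P, hPn, hPo, hPl, hPu, hPd⟩ := exists_cantor_sphere_patches hc0 hc1 hON hρ
  have hadm := admissible_of_cantorPoint hs0 hs1 hK hPl hPu Set.finite_empty
    (α := α) (by rw [Fintype.card_fin, hs, div_mul_cancel₀ _ hnpos.ne'])
  refine le_trans ?_ (dimH_chainSet_le_chainDim t hadm)
  have hlow := le_dimH_range_of_cantorPoint (ι := Fin (k + 1) × Fin n) hs0 hs1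
    (P := fun a j => P j fun i => a (j, i)) hK fun a b ji => (hPl ji.1 _ _ ji.2).trans
      (mul_le_mul_of_nonneg_left (dist_le_pi_dist (fun j => P j fun i => a (j, i))
        (fun j => P j fun i => b (j, i)) ji.1) hK)
  have hval : s * (Fintype.card (Fin (k + 1) × Fin n) : ℝ) = ((k : ℝ) + 1) * α := by
    rw [Fintype.card_prod, Fintype.card_fin, Fintype.card_fin, hs]
    push_cast
    field_simp
  rw [hval] at hlow
  refine hlow.trans (dimH_mono ?_)
  rintro _ ⟨a, rfl⟩
  refine ⟨fun j => .inl (Set.mem_iUnion.2 ⟨j, _, rfl⟩), fun i => ?_, fun j j' hjj => ?_⟩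
  · have hne : Fin.ofNat 2 i.castSucc.val ≠ Fin.ofNat 2 i.succ.val := by
      simp only [Fin.val_castSucc, Fin.val_succ, ne_eq, Fin.ext_iff, Fin.val_ofNat]
      omega
    have h1 := hPo i.castSucc i.succ (fun l => a (i.castSucc, l)) (fun l => a (i.succ, l))
      (horth _ _ hne)
    have h2 := norm_sub_sq_real (P i.castSucc fun l => a (i.castSucc, l))
      (P i.succ fun l => a (i.succ, l))
    rw [h1, hPn, hPn, mul_zero, sub_zero, hρt, ← dist_eq_norm] at h2
    exact (pow_left_inj₀ dist_nonneg (ht i).le two_ne_zero).1 h2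
  · by_contra hne
    -- Equal parity: the patches are disjoint by their shifts. Opposite parity: the points are
    -- orthogonal and nonzero, hence distinct.
    by_cases hpar : Fin.ofNat 2 j.val = Fin.ofNat 2 j'.val
    · exact hPd j j' _ _ hne (by simp only [he, hpar]) hjj
    · have h1 := hPo j j' (fun l => a (j, l)) (fun l => a (j', l)) (horth _ _ hpar)
      simp only at hjj
      rw [← hjj, real_inner_self_eq_norm_sq, hPn] at h1
      exact (pow_pos (hρ j) 2).ne' h1

/-! ### Planar 2-chains -/

theorem dist_sq_eq_plane (x y : EuclideanSpace ℝ (Fin 2)) :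
    dist x y ^ 2 = (x 0 - y 0) ^ 2 + (x 1 - y 1) ^ 2 := by
  rw [EuclideanSpace.dist_sq_eq, Fin.sum_univ_two, Real.dist_eq, Real.dist_eq, sq_abs, sq_abs]

theorem abs_apply_sub_le_dist {d : ℕ} (x y : EuclideanSpace ℝ (Fin d)) (i : Fin d) :
    |x i - y i| ≤ dist x y := by
  rw [dist_eq_norm]
  simpa using PiLp.norm_apply_le (x - y) i

theorem dist_le_abs_add_abs (x y : EuclideanSpace ℝ (Fin 2)) :
    dist x y ≤ |x 0 - y 0| + |x 1 - y 1| := by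
  refine (abs_le_of_sq_le_sq' ?_ (by positivity)).2
  rw [dist_sq_eq_plane, add_sq, sq_abs, sq_abs]
  have := mul_nonneg (abs_nonneg (x 0 - y 0)) (abs_nonneg (x 1 - y 1))
  linarith

/-- The determinant of two vectors of the plane. -/
def planeDet (v w : EuclideanSpace ℝ (Fin 2)) : ℝ := v 0 * w 1 - v 1 * w 0

theorem eq_or_eq_neg_smul_of_planeDet_eq_zero {v w : EuclideanSpace ℝ (Fin 2)}
    (hv : v ≠ 0) (h : planeDet v w = 0) :
    w = (‖w‖ / ‖v‖) • v ∨ w = (-(‖w‖ / ‖v‖)) • v := by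
  have hv2 : v 0 ^ 2 + v 1 ^ 2 ≠ 0 := by
    have h1 := dist_sq_eq_plane v 0
    simp only [PiLp.zero_apply, sub_zero, dist_zero_right] at h1
    rw [← h1]
    exact pow_ne_zero 2 (norm_ne_zero_iff.2 hv)
  obtain ⟨μ, hμ⟩ : ∃ μ : ℝ, w = μ • v := by
    refine ⟨(v 0 * w 0 + v 1 * w 1) / (v 0 ^ 2 + v 1 ^ 2), ?_⟩
    rw [planeDet] at h
    ext i
    fin_cases i
    · simp only [Fin.zero_eta, PiLp.smul_apply, smul_eq_mul]
      rw [div_mul_eq_mul_div, eq_div_iff hv2]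
      linear_combination -v 1 * h
    · simp only [Fin.mk_one, PiLp.smul_apply, smul_eq_mul]
      rw [div_mul_eq_mul_div, eq_div_iff hv2]
      linear_combination v 0 * h
  have hμ' : ‖w‖ / ‖v‖ = |μ| := by
    rw [hμ, norm_smul, Real.norm_eq_abs, mul_div_cancel_right₀ _ (norm_ne_zero_iff.2 hv)]
  rw [hμ']
  rcases abs_choice μ with h1 | h1
  · exact .inl (by rw [h1]; exact hμ)
  · exact .inr (by rw [h1, neg_neg]; exact hμ)

/-- Two planar `2`-chains with the same gaps: the displacement of the middle point is controlled
by those of the end points, as long as the chains are transversal. -/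
theorem abs_planeDet_mul_dist_le {x y : Fin 3 → EuclideanSpace ℝ (Fin 2)} {r s D : ℝ}
    (hx : dist (x 0) (x 1) = r) (hx' : dist (x 1) (x 2) = s)
    (hy : dist (y 0) (y 1) = r) (hy' : dist (y 1) (y 2) = s)
    (h0 : dist (x 0) (y 0) ≤ D) (h2 : dist (x 2) (y 2) ≤ D) :
    |planeDet ((x 1 - x 0) + (y 1 - y 0)) ((x 2 - x 1) + (y 2 - y 1))| * dist (x 1) (y 1) ≤
      32 * r * s * D := by
  have hr : 0 ≤ r := hx ▸ dist_nonneg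
  have hs : 0 ≤ s := hx' ▸ dist_nonneg
  have hD : 0 ≤ D := dist_nonneg.trans h0
  have ex := dist_sq_eq_plane (x 0) (x 1)
  have ey := dist_sq_eq_plane (y 0) (y 1)
  have ex' := dist_sq_eq_plane (x 1) (x 2)
  have ey' := dist_sq_eq_plane (y 1) (y 2)
  rw [hx] at ex; rw [hy] at ey; rw [hx'] at ex'; rw [hy'] at ey'
  set A : Fin 2 → ℝ := fun i => (x 1 i - x 0 i) + (y 1 i - y 0 i) with hA
  set B : Fin 2 → ℝ := fun i => (x 2 i - x 1 i) + (y 2 i - y 1 i) with hB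
  have hAb : ∀ i, |A i| ≤ 2 * r := fun i => by
    have h1 := abs_apply_sub_le_dist (x 0) (x 1) i
    have h2 := abs_apply_sub_le_dist (y 0) (y 1) i
    rw [abs_sub_comm] at h1 h2
    exact (abs_add_le _ _).trans (by linarith)
  have hBb : ∀ i, |B i| ≤ 2 * s := fun i => by
    have h1 := abs_apply_sub_le_dist (x 1) (x 2) i
    have h2 := abs_apply_sub_le_dist (y 1) (y 2) i
    rw [abs_sub_comm] at h1 h2
    exact (abs_add_le _ _).trans (by linarith)
  have hd0 : ∀ i, |x 0 i - y 0 i| ≤ D := fun i => (abs_apply_sub_le_dist _ _ i).trans h0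
  have hd2 : ∀ i, |x 2 i - y 2 i| ≤ D := fun i => (abs_apply_sub_le_dist _ _ i).trans h2
  set p : ℝ := A 0 * (x 0 0 - y 0 0) + A 1 * (x 0 1 - y 0 1) with hp
  set q : ℝ := B 0 * (x 2 0 - y 2 0) + B 1 * (x 2 1 - y 2 1) with hq
  have hpb : |p| ≤ 4 * r * D := by
    refine (abs_add_le _ _).trans ?_
    rw [abs_mul, abs_mul]
    exact (add_le_add (mul_le_mul (hAb 0) (hd0 0) (abs_nonneg _) (by positivity))
      (mul_le_mul (hAb 1) (hd0 1) (abs_nonneg _) (by positivity))).trans_eq (by ring)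
  have hqb : |q| ≤ 4 * s * D := by
    refine (abs_add_le _ _).trans ?_
    rw [abs_mul, abs_mul]
    exact (add_le_add (mul_le_mul (hBb 0) (hd2 0) (abs_nonneg _) (by positivity))
      (mul_le_mul (hBb 1) (hd2 1) (abs_nonneg _) (by positivity))).trans_eq (by ring)
  -- Subtracting two equal squared lengths and factoring the difference of squares gives an exact
  -- linear equation for the displacement of the middle point.
  have e1 : A 0 * (x 1 0 - y 1 0) + A 1 * (x 1 1 - y 1 1) = p := by
    simp only [hp, hA]
    linear_combination ey - ex
  have e2 : B 0 * (x 1 0 - y 1 0) + B 1 * (x 1 1 - y 1 1) = q := by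
    simp only [hq, hB]
    linear_combination ex' - ey'
  have hdet : planeDet ((x 1 - x 0) + (y 1 - y 0)) ((x 2 - x 1) + (y 2 - y 1)) =
      A 0 * B 1 - A 1 * B 0 := by
    simp [planeDet, hA, hB]
  rw [hdet]
  -- Cramer's rule for the two linear equations `e1` and `e2`.
  have hX : |A 0 * B 1 - A 1 * B 0| * |x 1 0 - y 1 0| ≤ 16 * r * s * D := by
    rw [← abs_mul, show (A 0 * B 1 - A 1 * B 0) * (x 1 0 - y 1 0) = p * B 1 - q * A 1 by
      rw [← e1, ← e2]; ring]
    refine (abs_sub _ _).trans ?_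
    rw [abs_mul, abs_mul]
    exact (add_le_add (mul_le_mul hpb (hBb 1) (abs_nonneg _) (by positivity))
      (mul_le_mul hqb (hAb 1) (abs_nonneg _) (by positivity))).trans_eq (by ring)
  have hY : |A 0 * B 1 - A 1 * B 0| * |x 1 1 - y 1 1| ≤ 16 * r * s * D := by
    rw [← abs_mul, show (A 0 * B 1 - A 1 * B 0) * (x 1 1 - y 1 1) = q * A 0 - p * B 0 by
      rw [← e1, ← e2]; ring]
    refine (abs_sub _ _).trans ?_
    rw [abs_mul, abs_mul]
    exact (add_le_add (mul_le_mul hqb (hAb 0) (abs_nonneg _) (by positivity))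
      (mul_le_mul hpb (hBb 0) (abs_nonneg _) (by positivity))).trans_eq (by ring)
  have hdist := dist_le_abs_add_abs (x 1) (y 1)
  calc _ ≤ _ := mul_le_mul_of_nonneg_left hdist (abs_nonneg _)
    _ ≤ 16 * r * s * D + 16 * r * s * D := by rw [mul_add]; exact add_le_add hX hY
    _ = _ := by ring

section

variable {t : Fin 2 → ℝ} {E : Set (EuclideanSpace ℝ (Fin 2))}

theorem dist_of_mem_chainSet {x : Fin 3 → EuclideanSpace ℝ (Fin 2)} (hx : x ∈ chainSet t E) :
    dist (x 0) (x 1) = t 0 ∧ dist (x 1) (x 2) = t 1 :=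
  ⟨hx.2.1 0, hx.2.1 1⟩

/-- On a collinear chain `x 2 = x 1 ± (t 1 / t 0) • (x 1 - x 0)`, so two linear maps recover all
such chains from their first two points. -/
theorem dimH_collinear_chains_le (ht : ∀ i, 0 < t i) :
    dimH {x ∈ chainSet t E | planeDet (x 1 - x 0) (x 2 - x 1) = 0} ≤
      dimH {x : Fin 2 → EuclideanSpace ℝ (Fin 2) | ∀ j, x j ∈ E} := by
  set f : ℝ → (Fin 2 → EuclideanSpace ℝ (Fin 2)) →L[ℝ] (Fin 3 → EuclideanSpace ℝ (Fin 2)) :=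
    fun μ => ContinuousLinearMap.pi ![.proj 0, .proj 1, .proj 1 + μ • (.proj 1 - .proj 0)] with hf
  have hsub : {x ∈ chainSet t E | planeDet (x 1 - x 0) (x 2 - x 1) = 0} ⊆
      f (t 1 / t 0) '' {x | ∀ j, x j ∈ E} ∪ f (-(t 1 / t 0)) '' {x | ∀ j, x j ∈ E} := by
    rintro x ⟨hx, hdet⟩
    obtain ⟨h0, h1⟩ := dist_of_mem_chainSet hx
    have hmem : ∀ j : Fin 2, ![x 0, x 1] j ∈ E := by
      intro j
      fin_cases j
      · exact hx.1 0
      · exact hx.1 1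
    have hv : ‖x 1 - x 0‖ = t 0 := by rw [← dist_eq_norm, dist_comm, h0]
    have hw : ‖x 2 - x 1‖ = t 1 := by rw [← dist_eq_norm, dist_comm, h1]
    have himg : ∀ μ : ℝ, x 2 - x 1 = μ • (x 1 - x 0) → f μ ![x 0, x 1] = x := by
      intro μ hμ
      ext1 j
      fin_cases j
      · simp [hf]
      · simp [hf]
      · simp [hf, ← hμ]
    have hne : x 1 - x 0 ≠ 0 := by
      rw [← norm_ne_zero_iff, hv]
      exact (ht 0).ne'
    rcases eq_or_eq_neg_smul_of_planeDet_eq_zero hne hdet with h | h <;> rw [hv, hw] at h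
    · exact .inl ⟨_, hmem, himg _ h⟩
    · exact .inr ⟨_, hmem, himg _ h⟩
  refine (dimH_mono hsub).trans ?_
  rw [dimH_union]
  exact max_le ((f _).lipschitz.dimH_image_le _) ((f _).lipschitz.dimH_image_le _)

/-- The middle point lies on two circles about the ends that cross transversally, so locally it is a
Lipschitz function of the ends. Hausdorff dimension is local: a set of larger dimension would have a
point all of whose relative neighbourhoods are too large. -/
theorem dimH_transversal_chains_le :
    dimH {x ∈ chainSet t E | planeDet (x 1 - x 0) (x 2 - x 1) ≠ 0} ≤
      dimH {x : Fin 2 → EuclideanSpace ℝ (Fin 2) | ∀ j, x j ∈ E} := by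
  by_contra! hlt
  obtain ⟨z, ⟨-, hz⟩, hloc⟩ := exists_mem_nhdsWithin_lt_dimH_of_lt_dimH hlt
  set G : (Fin 3 → EuclideanSpace ℝ (Fin 2)) × (Fin 3 → EuclideanSpace ℝ (Fin 2)) → ℝ :=
    fun p => |planeDet ((p.1 1 - p.1 0) + (p.2 1 - p.2 0)) ((p.1 2 - p.1 1) + (p.2 2 - p.2 1))|
    with hG
  have hGc : Continuous G := by
    simp only [hG, planeDet]
    fun_prop
  -- On the diagonal `G` is four times the absolute determinant of the chain; continuity keeps it
  -- above half that value near `z`.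
  have hGz : 0 < G (z, z) := by
    simp only [hG, planeDet, PiLp.add_apply, abs_pos]
    rw [planeDet] at hz
    intro h
    exact hz (by linear_combination h / 4)
  have hev := hGc.continuousAt.eventually (lt_mem_nhds (half_lt_self hGz))
  rw [nhds_prod_eq] at hev
  obtain ⟨U, hU, hUG⟩ := Filter.mem_prod_same_iff.1 hev
  set κ := G (z, z) / 2 with hκ
  have hκ0 : 0 < κ := half_pos hGz
  set W := {x ∈ chainSet t E | planeDet (x 1 - x 0) (x 2 - x 1) ≠ 0} ∩ U with hW
  refine (hloc W (Filter.inter_mem self_mem_nhdsWithin (mem_nhdsWithin_of_mem_nhds hU))).not_ge ?_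
  have hb := dimH_range_le_of_holder (Ω := W) (P := fun x => ![x.1 0, x.1 2])
    (Q := Subtype.val) (K := 1 + 32 * |t 0| * |t 1| / κ) (r := 1) one_pos (by
      intro x y
      rw [NNReal.coe_one, Real.rpow_one]
      set D := dist ![x.1 0, x.1 2] ![y.1 0, y.1 2] with hD
      have hD0 : 0 ≤ D := dist_nonneg
      have d0 : dist (x.1 0) (y.1 0) ≤ D :=
        dist_le_pi_dist ![x.1 0, x.1 2] ![y.1 0, y.1 2] 0
      have d2 : dist (x.1 2) (y.1 2) ≤ D :=
        dist_le_pi_dist ![x.1 0, x.1 2] ![y.1 0, y.1 2] 1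
      obtain ⟨hx0, hx1⟩ := dist_of_mem_chainSet x.2.1.1
      obtain ⟨hy0, hy1⟩ := dist_of_mem_chainSet y.2.1.1
      have h1 := abs_planeDet_mul_dist_le hx0 hx1 hy0 hy1 d0 d2
      have h2 : κ < G (x.1, y.1) := hUG (Set.mk_mem_prod x.2.2 y.2.2)
      have d1 : dist (x.1 1) (y.1 1) ≤ 32 * |t 0| * |t 1| / κ * D := by
        rw [div_mul_eq_mul_div, le_div_iff₀ hκ0, abs_of_nonneg (hx0 ▸ dist_nonneg),
          abs_of_nonneg (hx1 ▸ dist_nonneg), mul_comm]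
        exact (mul_le_mul_of_nonneg_right h2.le dist_nonneg).trans h1
      have hn : 0 ≤ 32 * |t 0| * |t 1| / κ * D := by positivity
      rw [add_mul, one_mul, dist_pi_le_iff (by positivity)]
      intro j
      fin_cases j
      · exact d0.trans (by linarith)
      · exact d1.trans (by linarith)
      · exact d2.trans (by linarith))
  rw [Subtype.range_coe, ENNReal.coe_one, div_one] at hb
  refine hb.trans (dimH_mono ?_)
  rintro _ ⟨x, rfl⟩ j
  fin_cases j
  · exact x.2.1.1.1 0
  · exact x.2.1.1.1 2

end

theorem chainDim_plane_eq {α : ℝ} {t : Fin 2 → ℝ} (hα : 0 < α) (hα1 : α ≤ 1)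
    (ht : ∀ i, 0 < t i) : chainDim 2 t α = ENNReal.ofReal (2 * α) := by
  refine le_antisymm (chainDim_le_of_forall fun E hE hr => ?_) ?_
  · have hpow := hr.dimH_pow_le hα hE 2
    rw [Nat.cast_ofNat] at hpow
    refine le_trans ?_ hpow
    have hsplit : chainSet t E ⊆ {x ∈ chainSet t E | planeDet (x 1 - x 0) (x 2 - x 1) = 0} ∪
        {x ∈ chainSet t E | planeDet (x 1 - x 0) (x 2 - x 1) ≠ 0} := fun x hx =>
      (em (planeDet (x 1 - x 0) (x 2 - x 1) = 0)).imp (fun h => ⟨hx, h⟩) fun h => ⟨hx, h⟩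
    refine (dimH_mono hsplit).trans ?_
    rw [dimH_union]
    exact max_le (dimH_collinear_chains_le ht) dimH_transversal_chains_le
  obtain ⟨e, he⟩ := exists_orthonormal_of_card_le (κ := Option (Fin 1)) (d := 2) (by simp)
  have hc0 : (0 : ℝ) < (1 / 2) ^ (1 / α) := by positivity
  have hc1 : ((1 / 2) ^ (1 / α) : ℝ) ≤ 1 / 2 := by
    have := Real.rpow_le_rpow_of_exponent_ge (x := 1 / 2) (by norm_num) (by norm_num)
      ((one_le_div hα).2 hα1)
    rwa [Real.rpow_one] at this
  obtain ⟨K, hK, P, hPn, -, hPl, hPu, hPd⟩ :=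
    exists_cantor_sphere_patches hc0 hc1 (e := fun _ : Fin 2 => e) (fun _ => he) ht
  -- The added origin is the common centre of the circles and the middle point of every chain used.
  have hadm := admissible_of_cantorPoint hα hα1 hK hPl hPu (Set.finite_singleton 0)
    (α := α) (by simp)
  refine le_trans ?_ (dimH_chainSet_le_chainDim t hadm)
  set Q : (Fin 2 → ℕ → Fin 2) → Fin 3 → EuclideanSpace ℝ (Fin 2) :=
    fun a => ![P 0 fun _ => a 0, 0, P 1 fun _ => a 1] with hQ
  have hlow := le_dimH_range_of_cantorPoint hα hα1 (P := Q) hK (by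
    intro a b i
    fin_cases i
    · exact (hPl 0 _ _ 0).trans (mul_le_mul_of_nonneg_left (dist_le_pi_dist (Q a) (Q b) 0) hK)
    · exact (hPl 1 _ _ 0).trans (mul_le_mul_of_nonneg_left (dist_le_pi_dist (Q a) (Q b) 2) hK))
  rw [Fintype.card_fin, Nat.cast_ofNat, mul_comm] at hlow
  refine hlow.trans (dimH_mono ?_)
  rintro _ ⟨a, rfl⟩
  have hne : ∀ j b, P j b ≠ 0 := fun j b => by
    rw [← norm_ne_zero_iff, hPn]
    exact (ht j).ne'
  -- The two circles coincide when `t 0 = t 1`; the disjointness of the patches still separates the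
  -- end points.
  have hne' : P 0 (fun _ => a 0) ≠ P 1 (fun _ => a 1) := hPd 0 1 _ _ (by simp) rfl
  refine ⟨fun j => ?_, fun i => ?_, fun j j' hjj => ?_⟩
  · fin_cases j
    · exact .inl (Set.mem_iUnion.2 ⟨0, _, rfl⟩)
    · exact .inr rfl
    · exact .inl (Set.mem_iUnion.2 ⟨1, _, rfl⟩)
  · fin_cases i
    · show dist (P 0 fun _ => a 0) 0 = t 0
      rw [dist_zero_right, hPn]
    · show dist 0 (P 1 fun _ => a 1) = t 1
      rw [dist_zero_left, hPn]
  · fin_cases j <;> fin_cases j' <;> first | rfl | (exfalso; simp [hQ] at hjj; first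
      | exact hne _ _ hjj | exact hne _ _ hjj.symm | exact hne' hjj | exact hne' hjj.symm)

theorem theorem1p7 :
    (∀ (k d : ℕ) (α : ℝ) (t : Fin k → ℝ), 1 ≤ k → 4 ≤ d →
      0 < α → α ≤ ((d / 2 : ℕ) : ℝ) - 1 → (∀ i, 0 < t i) → Monotone t →
        chainDim d t α = ENNReal.ofReal (((k : ℝ) + 1) * α)) ∧
    (∀ (α : ℝ) (t : Fin 2 → ℝ), 0 < α → α ≤ 1 → (∀ i, 0 < t i) →
        chainDim 2 t α = ENNReal.ofReal (2 * α)) :=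
  ⟨fun _ _ _ _ hk hd hα hαd ht hm => chainDim_eq_of_monotone hk hd hα hαd ht hm,
    fun _ _ hα hα1 ht => chainDim_plane_eq hα hα1 ht⟩
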